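/- Let $M$ be a smooth manifold of dimension $m\ge 0$ (Hausdorff, second countable, without boundary). Let $q^2\colon E^2\to M$ be the bundle of 2-jets $j^2_pg$ of Riemannian metrics $g$ defined near points $p\in M$: two such metrics have the same 2-jet at $p$ if in local coordinates they have the same partial derivatives up to order two at $p$, and $E^2$ carries the topology for which every chart $(U,\Phi)$ of $M$ induces a homeomorphism $j^2_pg\mapsto(\Phi(p),g_{ij},\partial_kg_{ij},\partial_l\partial_kg_{ij})$ of $(q^2)^{-1}(U)$ onto its image. For $\tau=j^2_pg\in E^2$ and a plane $V\subset T_pM$ let $\sec_\tau V$ be the sectional curvature of $V$ with respect to the Levi-Civita connection of $g$; it depends only on $\tau$. For $a\in\mathbb R$ and $\delta\ge 0$ let $$\mathcal R_{\delta,a}=\{\tau\in E^2:\ \sec_\tau V\in(a-\delta,a+\delta)\text{ for all planes }V\subset T_{q^2(\tau)}M\},$$ where $(a,a)$ is read as $\{a\}$ if $\delta=0$. A formal solution of $\mathcal R_{\delta,a}$ is a continuous section $\alpha\colon M\to E^2$ of $q^2$ with $\alpha(M)\subset\mathcal R_{\delta,a}$. Then for every $a\in\mathbb R$ and every $\delta\ge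 0$ the space of formal solutions of $\mathcal R_{\delta,a}$ is nonempty. In particular (for $\delta=0$) there is a continuous section of $E^2$ all of whose values have all sectional curvatures equal to $a$. -/

import Mathlib

open Set Bundle Manifold
open scoped ContDiff Topology

-- Let instance search find the usual manifold structure of a model space directly.
attribute [local instance high] chartedSpaceSelf

noncomputable section

namespace CurvatureRelation

/-- The model space `ℝᵐ`. -/
abbrev Model (m : ℕ) : Type := EuclideanSpace ℝ (Fin m)

/-- The standard basis vectors of `ℝᵐ`. -/
abbrev stdVec {m : ℕ} (i : Fin m) : Model m := EuclideanSpace.single i 1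

/-- The partial derivative `∂ₖ f` of a function on `ℝᵐ`. -/
def partialDeriv {m : ℕ} (k : Fin m) (f : Model m → ℝ) (y : Model m) : ℝ :=
  fderiv ℝ f y (stdVec k)

/-- Arrays `(τ_{ij}, τ_{ijk}, τ_{ijkl})`, the ambient space of the local descriptions
`(g_{ij}, ∂ₖ g_{ij}, ∂ₗ ∂ₖ g_{ij})` of 2-jets of metrics. -/
abbrev JetArray (m : ℕ) : Type :=
  (Fin m → Fin m → ℝ) × (Fin m → Fin m → Fin m → ℝ) × (Fin m → Fin m → Fin m → Fin m → ℝ)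

/-! ### Riemannian geometry in coordinates

A metric on a subset of `ℝᵐ` is given by its components `g i j : ℝᵐ → ℝ`. -/

section Coordinates

variable {m : ℕ}

/-- The 2-jet at `y` of a matrix of functions, as the array of its partial derivatives. -/
def jetArrayAt (g : Fin m → Fin m → Model m → ℝ) (y : Model m) : JetArray m :=
  (fun i j => g i j y,
   fun i j k => partialDeriv k (g i j) y,
   fun i j k l => partialDeriv l (partialDeriv k (g i j)) y)

/-- The Christoffel symbols `Γ_{ij}^k` of the Levi-Civita connection,
`Γ_{ij}^k = ½ ∑ₗ g^{lk} (∂ᵢ g_{jl} + ∂ⱼ g_{li} - ∂ₗ g_{ij})`. -/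
def christoffel (g : Fin m → Fin m → Model m → ℝ) (i j k : Fin m) (y : Model m) : ℝ :=
  (1 / 2) * ∑ l, (Matrix.of fun a b => g a b y)⁻¹ l k *
    (partialDeriv i (g j l) y + partialDeriv j (g l i) y - partialDeriv l (g i j) y)

/-- The `s`-th component of `R(∂ᵢ, ∂ⱼ) ∂ₖ = ∇_{∂ⱼ} ∇_{∂ᵢ} ∂ₖ - ∇_{∂ᵢ} ∇_{∂ⱼ} ∂ₖ`. -/
def curvatureComponent (g : Fin m → Fin m → Model m → ℝ) (i j k s : Fin m) (y : Model m) : ℝ :=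
  partialDeriv j (christoffel g i k s) y - partialDeriv i (christoffel g j k s) y +
    ∑ l, (christoffel g i k l y * christoffel g j l s y -
      christoffel g j k l y * christoffel g i l s y)

/-- `g(R(v, w) v, w)` for vectors with components `v i`, `w i`. -/
def curvatureForm (g : Fin m → Fin m → Model m → ℝ) (y : Model m) (v w : Model m) : ℝ :=
  ∑ i, ∑ j, ∑ k, ∑ s, (∑ l, curvatureComponent g i j k l y * g l s y) * v i * w j * v k * w s

/-- `g(v, w)` for vectors with components `v i`, `w i`. -/
def metricForm (g : Fin m → Fin m → Model m → ℝ) (y : Model m) (v w : Model m) : ℝ :=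
  ∑ i, ∑ j, g i j y * v i * w j

/-- The sectional curvature `g(R(v, w) v, w) / (g(v, v) g(w, w) - g(v, w)²)` of the plane
spanned by linearly independent vectors `v`, `w` at `y`. -/
def coordSec (g : Fin m → Fin m → Model m → ℝ) (y : Model m) (v w : Model m) : ℝ :=
  curvatureForm g y v w /
    (metricForm g y v v * metricForm g y w w - metricForm g y v w ^ 2)

/-- The Christoffel symbol as a function of the values and first derivatives of the metric. -/
def christoffelAlg (i j k : Fin m)
    (τ : (Fin m → Fin m → ℝ) × (Fin m → Fin m → Fin m → ℝ)) : ℝ :=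
  (1 / 2) * ∑ l, (Matrix.of τ.1)⁻¹ l k * (τ.2 j l i + τ.2 l i j - τ.2 i j l)

theorem differentiableAt_christoffelAlg (i j k : Fin m)
    (τ : (Fin m → Fin m → ℝ) × (Fin m → Fin m → Fin m → ℝ)) (h : (Matrix.of τ.1).det ≠ 0) :
    DifferentiableAt ℝ (christoffelAlg i j k) τ := by
  have hdet : ∀ (F : (Fin m → Fin m → ℝ) × (Fin m → Fin m → Fin m → ℝ) → Matrix (Fin m) (Fin m) ℝ),
      (∀ a b, DifferentiableAt ℝ (fun σ => F σ a b) τ) →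
      DifferentiableAt ℝ (fun σ => (F σ).det) τ := by
    intro F hF
    simp only [Matrix.det_apply]
    refine DifferentiableAt.fun_sum fun p _ => ?_
    refine DifferentiableAt.const_smul ?_ _
    have := (HasFDerivAt.finsetProd (u := Finset.univ) (g := fun a σ => F σ (p a) a)
      (fun a _ => (hF (p a) a).hasFDerivAt)).differentiableAt
    exact this
  have hc1 : ∀ a b, DifferentiableAt ℝ
      (fun σ : (Fin m → Fin m → ℝ) × (Fin m → Fin m → Fin m → ℝ) => σ.1 a b) τ := by
    intro a b; fun_prop
  have hc2 : ∀ a b c, DifferentiableAt ℝ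
      (fun σ : (Fin m → Fin m → ℝ) × (Fin m → Fin m → Fin m → ℝ) => σ.2 a b c) τ := by
    intro a b c; fun_prop
  unfold christoffelAlg
  refine DifferentiableAt.const_mul ?_ _
  refine DifferentiableAt.fun_sum fun l _ => ?_
  refine DifferentiableAt.mul ?_ (((hc2 _ _ _).add (hc2 _ _ _)).sub (hc2 _ _ _))
  simp only [Matrix.inv_def, Matrix.smul_apply, smul_eq_mul, Ring.inverse_eq_inv']
  refine DifferentiableAt.mul (DifferentiableAt.inv (hdet _ hc1) h) ?_
  simp only [Matrix.adjugate_apply]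
  refine hdet _ fun a b => ?_
  by_cases ha : a = k
  · subst ha; simp
  · simp only [Matrix.updateRow_ne ha]; exact hc1 a b

theorem fderiv_eq_of_partialDeriv_eq {f f' : Model m → ℝ} {y : Model m}
    (h : ∀ k, partialDeriv k f y = partialDeriv k f' y) : fderiv ℝ f y = fderiv ℝ f' y := by
  ext v
  have hv : v = ∑ k, v k • stdVec k := by
    ext a; simp [stdVec, Pi.single_apply]
  rw [hv]
  simp only [map_sum, map_smul]
  exact Finset.sum_congr rfl fun k _ => by rw [show fderiv ℝ f y (stdVec k) = _ from h k]; rfl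

/-- The sectional curvature depends only on the 2-jet of the metric. -/
theorem coordSec_congr {g g' : Fin m → Fin m → Model m → ℝ} {y : Model m}
    (hg : ∀ i j, ContDiffAt ℝ 2 (g i j) y) (hg' : ∀ i j, ContDiffAt ℝ 2 (g' i j) y)
    (hdet : (Matrix.of fun i j => g i j y).det ≠ 0)
    (h : jetArrayAt g y = jetArrayAt g' y) (v w : Model m) :
    coordSec g y v w = coordSec g' y v w := by
  simp only [jetArrayAt, Prod.mk.injEq] at h
  obtain ⟨h0, h1, h2⟩ := h
  have h0' : ∀ i j, g i j y = g' i j y := fun i j => congrFun (congrFun h0 i) j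
  have h1' : ∀ i j k, partialDeriv k (g i j) y = partialDeriv k (g' i j) y :=
    fun i j k => congrFun (congrFun (congrFun h1 i) j) k
  have h2' : ∀ i j k l, partialDeriv l (partialDeriv k (g i j)) y =
      partialDeriv l (partialDeriv k (g' i j)) y :=
    fun i j k l => congrFun (congrFun (congrFun (congrFun h2 i) j) k) l
  have hpd : ∀ {f : Model m → ℝ}, ContDiffAt ℝ 2 f y → ∀ k,
      DifferentiableAt ℝ (partialDeriv k f) y := by
    intro f hf k
    have : ContDiffAt ℝ 1 (fderiv ℝ f) y := hf.fderiv_right (by norm_num)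
    exact (this.differentiableAt (by norm_num)).clm_apply (differentiableAt_const _)
  have key : ∀ {f : Fin m → Fin m → Model m → ℝ}, (∀ i j, ContDiffAt ℝ 2 (f i j) y) →
      HasFDerivAt (fun z => ((fun i j => f i j z, fun i j k => partialDeriv k (f i j) z) :
        (Fin m → Fin m → ℝ) × (Fin m → Fin m → Fin m → ℝ)))
        ((ContinuousLinearMap.pi fun i => ContinuousLinearMap.pi fun j =>
            fderiv ℝ (f i j) y).prod
          (ContinuousLinearMap.pi fun i => ContinuousLinearMap.pi fun j =>
            ContinuousLinearMap.pi fun k => fderiv ℝ (partialDeriv k (f i j)) y)) y := by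
    intro f hf
    refine HasFDerivAt.prodMk ?_ ?_
    · exact hasFDerivAt_pi.2 fun i => hasFDerivAt_pi.2 fun j =>
        ((hf i j).differentiableAt (by norm_num)).hasFDerivAt
    · exact hasFDerivAt_pi.2 fun i => hasFDerivAt_pi.2 fun j => hasFDerivAt_pi.2 fun k =>
        (hpd (hf i j) k).hasFDerivAt
  have hΓ : ∀ i j k, christoffel g i j k y = christoffel g' i j k y := by
    intro i j k
    simp only [christoffel, h0', h1']
  have hdΓ : ∀ i j k l, partialDeriv l (christoffel g i j k) y =
      partialDeriv l (christoffel g' i j k) y := by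
    intro i j k l
    have e1 := (differentiableAt_christoffelAlg i j k
      (fun i j => g i j y, fun i j k => partialDeriv k (g i j) y) hdet).hasFDerivAt.comp y (key hg)
    have e2 := (differentiableAt_christoffelAlg i j k
      (fun i j => g' i j y, fun i j k => partialDeriv k (g' i j) y)
        (by simpa only [h0'] using hdet)).hasFDerivAt.comp y (key hg')
    have e1' : HasFDerivAt (christoffel g i j k) _ y := e1
    have e2' : HasFDerivAt (christoffel g' i j k) _ y := e2
    unfold partialDeriv at *
    rw [e1'.fderiv, e2'.fderiv]
    have a1 : ∀ i j, fderiv ℝ (g i j) y = fderiv ℝ (g' i j) y :=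
      fun i j => fderiv_eq_of_partialDeriv_eq fun k => h1' i j k
    have a2 : ∀ i j k, fderiv ℝ (fun z => fderiv ℝ (g i j) z (stdVec k)) y =
        fderiv ℝ (fun z => fderiv ℝ (g' i j) z (stdVec k)) y :=
      fun i j k => fderiv_eq_of_partialDeriv_eq fun l => h2' i j k l
    simp only [h0', a1, a2]
  simp only [coordSec, curvatureForm, curvatureComponent, metricForm, h0', hΓ, hdΓ]

end Coordinates

/-! ### 2-jets of local Riemannian metrics on a manifold -/

section Manifold

variable (m : ℕ) (M : Type*) [TopologicalSpace M] [ChartedSpace (Model m) M]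

/-- The charts of the smooth structure. -/
abbrev charts : Set (OpenPartialHomeomorph M (Model m)) :=
  IsManifold.maximalAtlas 𝓘(ℝ, Model m) ∞ M

variable [IsManifold 𝓘(ℝ, Model m) ∞ M]

/-- A smooth Riemannian metric on an open neighbourhood `dom` of a point `base`; the values
of `inner` outside `dom` are irrelevant. -/
structure LocalMetric where
  base : M
  dom : Set M
  isOpen_dom : IsOpen dom
  base_mem : base ∈ dom
  inner (x : M) : TangentSpace 𝓘(ℝ, Model m) x →L[ℝ] TangentSpace 𝓘(ℝ, Model m) x →L[ℝ] ℝ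
  symm : ∀ x ∈ dom, ∀ v w, inner x v w = inner x w v
  pos : ∀ x ∈ dom, ∀ v, v ≠ 0 → 0 < inner x v v
  contMDiffOn : ContMDiffOn 𝓘(ℝ, Model m)
    (𝓘(ℝ, Model m).prod 𝓘(ℝ, Model m →L[ℝ] Model m →L[ℝ] ℝ)) ∞
    (fun x => TotalSpace.mk' (Model m →L[ℝ] Model m →L[ℝ] ℝ)
      (E := fun x : M => TangentSpace 𝓘(ℝ, Model m) x →L[ℝ] TangentSpace 𝓘(ℝ, Model m) x →L[ℝ] ℝ)
      x (inner x)) dom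

variable {m M}

namespace LocalMetric

/-- The components `g_{ij} = g(∂ᵢ, ∂ⱼ)` of the metric in the chart `e`, as functions of the
coordinates; here `∂ᵢ` is the image of the standard basis vector under the derivative of `e⁻¹`. -/
def component (g : LocalMetric m M) (e : OpenPartialHomeomorph M (Model m)) (i j : Fin m)
    (y : Model m) : ℝ :=
  g.inner (e.symm y)
    (mfderiv 𝓘(ℝ, Model m) 𝓘(ℝ, Model m) e.symm y (stdVec i))
    (mfderiv 𝓘(ℝ, Model m) 𝓘(ℝ, Model m) e.symm y (stdVec j))

/-- The local description `(g_{ij}, ∂ₖ g_{ij}, ∂ₗ ∂ₖ g_{ij})` of the 2-jet in the chart `e`. -/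
def jetCoord (g : LocalMetric m M) (e : OpenPartialHomeomorph M (Model m)) : JetArray m :=
  jetArrayAt (g.component e) (e g.base)

theorem contDiffAt_component (g : LocalMetric m M) {e : OpenPartialHomeomorph M (Model m)}
    (he : e ∈ charts m M) (hb : g.base ∈ e.source) (i j : Fin m) :
    ContDiffAt ℝ 2 (g.component e i j) (e g.base) := by
  have hyt : e g.base ∈ e.target := e.map_source hb
  have hsymm : ContMDiffOn 𝓘(ℝ, Model m) 𝓘(ℝ, Model m) ∞ e.symm e.target :=
    contMDiffOn_symm_of_mem_maximalAtlas he
  have hsymmAt : ContMDiffAt 𝓘(ℝ, Model m) 𝓘(ℝ, Model m) ∞ e.symm (e g.base) :=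
    hsymm.contMDiffAt (e.open_target.mem_nhds hyt)
  have hψ := ContMDiffAt.comp_of_eq
    (g.contMDiffOn.contMDiffAt (g.isOpen_dom.mem_nhds g.base_mem)) hsymmAt (e.left_inv hb)
  have hv : ∀ k : Fin m, ContMDiffAt 𝓘(ℝ, Model m) (𝓘(ℝ, Model m).prod 𝓘(ℝ, Model m)) ∞
      (fun y : Model m => (TotalSpace.mk' (Model m) (E := TangentSpace 𝓘(ℝ, Model m)) (e.symm y)
        (mfderiv 𝓘(ℝ, Model m) 𝓘(ℝ, Model m) e.symm y (stdVec k)) :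
          TangentBundle 𝓘(ℝ, Model m) M)) (e g.base) := by
    intro k
    have h1 := hsymm.contMDiffOn_tangentMapWithin (m := ∞) (by simp)
      e.open_target.uniqueMDiffOn
    have hc : ContMDiff 𝓘(ℝ, Model m) (𝓘(ℝ, Model m).prod 𝓘(ℝ, Model m)) ∞
        (fun y : Model m => (TotalSpace.mk' (Model m) (E := TangentSpace 𝓘(ℝ, Model m)) y
          (stdVec k : Model m) : TangentBundle 𝓘(ℝ, Model m) (Model m))) := by
      intro y
      rw [Bundle.contMDiffAt_totalSpace]
      refine ⟨contMDiffAt_id, ?_⟩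
      simp only [trivializationAt_model_space_apply]
      exact contMDiffAt_const
    have h2 := h1.comp (s := e.target) hc.contMDiffOn (fun y hy => hy)
    refine (h2.contMDiffAt (e.open_target.mem_nhds hyt)).congr_of_eventuallyEq ?_
    filter_upwards [e.open_target.mem_nhds hyt] with y hy
    simp only [Function.comp, tangentMapWithin]
    rw [mfderivWithin_of_isOpen e.open_target hy]
  have h := ContMDiffAt.clm_bundle_apply₂ (F₃ := ℝ) (E₃ := Bundle.Trivial M ℝ) hψ (hv i) (hv j)
  rw [Bundle.contMDiffAt_totalSpace] at h
  have h' : ContMDiffAt 𝓘(ℝ, Model m) 𝓘(ℝ) ∞ (g.component e i j) (e g.base) := h.2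
  exact h'.contDiffAt.of_le (by norm_cast)

theorem sum_bilin {E : Type*} [AddCommGroup E] [Module ℝ E] [TopologicalSpace E]
    (B : E →L[ℝ] E →L[ℝ] ℝ) (D : Model m →L[ℝ] E) (v : Fin m → ℝ) :
    B (D (∑ k, v k • stdVec k)) (D (∑ k, v k • stdVec k)) =
      ∑ i, v i * (Matrix.of fun i j => B (D (stdVec i)) (D (stdVec j))).mulVec v i := by
  have hB : ∀ w, B (D (∑ k, v k • stdVec k)) w = ∑ k, v k * B (D (stdVec k)) w := by
    intro w
    simp [map_sum, map_smul]
  rw [hB]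
  refine Finset.sum_congr rfl fun i _ => ?_
  simp only [map_sum, map_smul, Matrix.mulVec, dotProduct, Matrix.of_apply, smul_eq_mul]
  congr 1
  exact Finset.sum_congr rfl fun j _ => mul_comm _ _

theorem det_component_ne_zero (g : LocalMetric m M) {e : OpenPartialHomeomorph M (Model m)}
    (he : e ∈ charts m M) (hb : g.base ∈ e.source) :
    (Matrix.of fun i j => g.component e i j (e g.base)).det ≠ 0 := by
  intro hdet
  obtain ⟨v, hv0, hv⟩ := Matrix.exists_mulVec_eq_zero_iff.2 hdet
  have hyt : e g.base ∈ e.target := e.map_source hb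
  have hsymm : ContMDiffAt 𝓘(ℝ, Model m) 𝓘(ℝ, Model m) ∞ e.symm (e g.base) :=
    (contMDiffOn_symm_of_mem_maximalAtlas he).contMDiffAt (e.open_target.mem_nhds hyt)
  have hes : ContMDiffAt 𝓘(ℝ, Model m) 𝓘(ℝ, Model m) ∞ e (e.symm (e g.base)) :=
    contMDiffAt_of_mem_maximalAtlas he (e.map_target hyt)
  set D := mfderiv 𝓘(ℝ, Model m) 𝓘(ℝ, Model m) e.symm (e g.base) with hD
  have hinj : ∀ u, D u = 0 → u = 0 := by
    intro u hu
    have hc := mfderiv_comp (e g.base) (hes.mdifferentiableAt (by simp))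
      (hsymm.mdifferentiableAt (by simp))
    have hid : mfderiv 𝓘(ℝ, Model m) 𝓘(ℝ, Model m) (e ∘ e.symm) (e g.base) =
        ContinuousLinearMap.id ℝ _ := by
      rw [← mfderiv_id]
      refine Filter.EventuallyEq.mfderiv_eq ?_
      filter_upwards [e.open_target.mem_nhds hyt] with y hy using e.right_inv hy
    have := congrArg (fun L => L u) (hid.symm.trans hc)
    simp only [ContinuousLinearMap.comp_apply] at this
    rw [← hD, hu] at this
    simp only [map_zero] at this
    exact this
  set u : Model m := ∑ k, v k • stdVec k with hu
  have hsum : g.inner (e.symm (e g.base)) (D u) (D u) = 0 := by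
    have : g.inner (e.symm (e g.base)) (D u) (D u) =
        ∑ i, v i * (Matrix.of fun i j => g.component e i j (e g.base)).mulVec v i := by
      exact sum_bilin (E := TangentSpace 𝓘(ℝ, Model m) (e.symm (e g.base))) _ D v
    rw [this, hv]; simp
  have hDu : D u = 0 := by
    by_contra hne
    have hp := g.pos (e.symm (e g.base)) (by rw [e.left_inv hb]; exact g.base_mem) (D u) hne
    exact hp.ne' hsum
  have hu0 := hinj u hDu
  refine hv0 (funext fun a => ?_)
  have := congrArg (fun x : Model m => x a) hu0
  simp only [hu] at this
  simpa [stdVec, Pi.single_apply] using this.trans (show (0 : Model m) a = 0 from rfl)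

/-- The sectional curvature at `x` of the plane spanned by the linearly independent tangent
vectors `v`, `w`. It is computed from the components of the metric and of `v`, `w` in the
preferred chart around `x`; the result does not depend on the chart. -/
def sec (g : LocalMetric m M) (x : M) (v w : TangentSpace 𝓘(ℝ, Model m) x) : ℝ :=
  coordSec (g.component (chartAt (Model m) x)) (chartAt (Model m) x x)
    (mfderiv 𝓘(ℝ, Model m) 𝓘(ℝ, Model m) (chartAt (Model m) x) x v)
    (mfderiv 𝓘(ℝ, Model m) 𝓘(ℝ, Model m) (chartAt (Model m) x) x w)

/-- Two local metrics have the same 2-jet if they have the same base point and, in local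
coordinates around it, the same partial derivatives up to order two there. -/
instance jetSetoid : Setoid (LocalMetric m M) where
  r g g' := g.base = g'.base ∧
    ∀ e ∈ charts m M, g.base ∈ e.source → g.jetCoord e = g'.jetCoord e
  iseqv :=
    { refl := fun _ => ⟨rfl, fun _ _ _ => rfl⟩
      symm := fun ⟨h, k⟩ => ⟨h.symm, fun e he hb => (k e he (h ▸ hb)).symm⟩
      trans := fun ⟨h, k⟩ ⟨h', k'⟩ => ⟨h.trans h', fun e he hb =>
        (k e he hb).trans (k' e he (h ▸ hb))⟩ }

theorem sec_congr {g g' : LocalMetric m M} (h : g ≈ g') : g.sec g.base = g'.sec g.base := by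
  obtain ⟨hb, hj⟩ := h
  have he : chartAt (Model m) g.base ∈ charts m M := IsManifold.chart_mem_maximalAtlas g.base
  have hs : g.base ∈ (chartAt (Model m) g.base).source := mem_chart_source _ _
  have hs' : g'.base ∈ (chartAt (Model m) g.base).source := hb ▸ hs
  have hc' := g'.contDiffAt_component he hs'
  have hj' := hj _ he hs
  rw [jetCoord, jetCoord, ← hb] at hj'
  rw [← hb] at hc'
  funext v w
  exact coordSec_congr (g.contDiffAt_component he hs) hc' (g.det_component_ne_zero he hs) hj' _ _

end LocalMetric

variable (m M) in
/-- The space `E²` of 2-jets of local Riemannian metrics on `M`. -/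
def MetricJet : Type _ := Quotient (LocalMetric.jetSetoid (m := m) (M := M))

namespace MetricJet

/-- The 2-jet of a local metric at its base point. -/
def mk (g : LocalMetric m M) : MetricJet m M := Quotient.mk _ g

/-- The projection `q² : E² → M`. -/
def proj (τ : MetricJet m M) : M :=
  Quotient.lift LocalMetric.base (fun _ _ h => And.left h) τ

/-- The local description of a 2-jet in a chart around its base point
(and the junk value `0` if the base point is not in the domain of the chart). -/
def coord (e : charts m M) (τ : MetricJet m M) : JetArray m :=
  open Classical in
  Quotient.lift (fun g : LocalMetric m M => if g.base ∈ e.1.source then g.jetCoord e.1 else 0)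
    (fun g g' h => by
      by_cases hb : g.base ∈ e.1.source
      · have hb' : g'.base ∈ e.1.source := h.1 ▸ hb
        simp only [hb, hb', if_true]
        exact h.2 e.1 e.2 hb
      · have hb' : g'.base ∉ e.1.source := h.1 ▸ hb
        simp only [hb, hb', if_false]) τ

/-- The topology of the bundle `E²`: its open sets are generated by the sets that are open in the
local descriptions `(q²)⁻¹(U) → ℝᵐ × P(m)²`, `τ ↦ (Φ(q²(τ)), (τ_{ij}, τ_{ijk}, τ_{ijkl}))`
for the charts `(U, Φ)` of `M`. -/
instance : TopologicalSpace (MetricJet m M) :=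
  TopologicalSpace.generateFrom
    {O | ∃ (e : charts m M) (W : Set (Model m × JetArray m)), IsOpen W ∧
      O = {τ | τ.proj ∈ e.1.source ∧ (e.1 τ.proj, coord e τ) ∈ W}}

/-- The sectional curvature `sec_τ V` of a 2-jet `τ` represented by a local metric `g`, where
`V` is the plane spanned by the linearly independent vectors `v`, `w` in the tangent space at
the base point: it is the sectional curvature of `V` with respect to `g`. -/
def sec (τ : MetricJet m M) :
    TangentSpace 𝓘(ℝ, Model m) τ.proj → TangentSpace 𝓘(ℝ, Model m) τ.proj → ℝ :=
  Quotient.hrecOn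
    (motive := fun τ : MetricJet m M =>
      TangentSpace 𝓘(ℝ, Model m) τ.proj → TangentSpace 𝓘(ℝ, Model m) τ.proj → ℝ)
    τ (fun g => g.sec g.base) (fun g g' h => by
      have hb : g.base = g'.base := h.1
      rw [LocalMetric.sec_congr h, hb]
      exact HEq.rfl)

end MetricJet

end Manifold

/-- The interval `(a - δ, a + δ)`, to be read as `{a}` if `δ = 0`. -/
def pinchInterval (δ a : ℝ) : Set ℝ :=
  open Classical in if δ = 0 then {a} else Ioo (a - δ) (a + δ)

section Relation

variable (m : ℕ) (M : Type*) [TopologicalSpace M] [ChartedSpace (Model m) M]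
  [IsManifold 𝓘(ℝ, Model m) ∞ M]

/-- The curvature relation `R_{δ,a} ⊆ E²`: the 2-jets all of whose sectional curvatures lie in
`(a - δ, a + δ)`. -/
def relation (δ a : ℝ) : Set (MetricJet m M) :=
  {τ | ∀ v w : TangentSpace 𝓘(ℝ, Model m) τ.proj, LinearIndependent ℝ ![v, w] →
    τ.sec v w ∈ pinchInterval δ a}

/-- The space of formal solutions of the curvature relation: the continuous sections of
`q² : E² → M` with values in `R_{δ,a}`. -/
def formalSolutions (δ a : ℝ) : Set C(M, MetricJet m M) :=
  {α | (∀ p, (α p).proj = p) ∧ ∀ p, α p ∈ relation m M δ a}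

end Relation

end CurvatureRelation

end

/-! A formal solution need not be the 2-jet of a global metric, so it suffices to choose, at every
point `p` separately, a germ of a metric with constant sectional curvature `a` at `p`, provided its
2-jet depends continuously on `p`.

If `ψ` is a coordinate system vanishing at `p` and `B` a scalar product, the metric `(1 - a/2
B(ψ,ψ)) B(dψ,dψ)` has the same 2-jet at `p` as the space form of curvature `a` in stereographic
coordinates, whose conformal factor is `(1 + a/4 |x|²)⁻² = 1 - a/2 |x|² + O(|x|⁴)`. If `ψ` is
normalized to have derivative the identity in a chart `e`, that 2-jet in `e` is a polynomial
expression, `modelJet`, in `B` and the second and third derivatives `Q`, `C` of `ψ` there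
(`jetArrayAt_pullMetric`). Its curvature is computed algebraically from the symmetries of `B`, `Q`
and `C` (`sum_curvatureComponent_mul`, `coordSec_of_modelJet`): `Q` and `C` describe only the change
from flat coordinates and cancel.

It remains to choose `ψ` and `B` continuously in `p`, without a global coordinate system. Coordinate
systems normalized to vanish at `p` and to have a prescribed derivative there form an affine space,
and scalar products form a convex set, so both can be averaged with a partition of unity
(`coordMap`, `scalarProd`). The weights are frozen at `p`: `ψ` is then smooth in `x`, and its
derivatives at `p` are weighted sums of derivatives of transition maps, continuous in `p`. Changing
the chart used for the normalization changes `ψ` by a linear map and `B` correspondingly, hence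
leaves the metric alone (`coordMap_change`, `scalarProd_change`, `pullMetric_clm_comp`). So a single
germ at `p` has the expected 2-jet in every chart (`exists_localMetric_jetCoord_eq`). -/

noncomputable section

namespace CurvatureRelation

/-! ### Curvature of a metric with the model 2-jet -/

section Curvature

variable {m : ℕ}

/-- The 2-jet at the origin, in coordinates `φ` with `φ = 0`, `dφ = id`, `d²φ = Q`, `d³φ = C`
there, of the metric `(1 - a/2 |φ|²) |dφ|²`, where `|·|²` is the quadratic form of `B`. -/
def modelJet (a : ℝ) (B : Model m →L[ℝ] Model m →L[ℝ] ℝ)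
    (Q : Model m →L[ℝ] Model m →L[ℝ] Model m)
    (C : Model m →L[ℝ] Model m →L[ℝ] Model m →L[ℝ] Model m) : JetArray m :=
  (fun i j => B (stdVec i) (stdVec j),
   fun i j k => B (Q (stdVec k) (stdVec i)) (stdVec j) + B (stdVec i) (Q (stdVec k) (stdVec j)),
   fun i j k l =>
    B (C (stdVec l) (stdVec k) (stdVec i)) (stdVec j) +
      B (stdVec i) (C (stdVec l) (stdVec k) (stdVec j)) +
      B (Q (stdVec k) (stdVec i)) (Q (stdVec l) (stdVec j)) +
      B (Q (stdVec l) (stdVec i)) (Q (stdVec k) (stdVec j)) -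
      a * B (stdVec k) (stdVec l) * B (stdVec i) (stdVec j))

theorem sum_smul_stdVec (v : Model m) : ∑ k, v k • stdVec k = v := by
  ext a; simp [stdVec, Pi.single_apply]

theorem sum_apply_stdVec {F : Type*} [AddCommMonoid F] [Module ℝ F] [TopologicalSpace F]
    (f : Model m →L[ℝ] F) (v : Model m) : ∑ k, v k • f (stdVec k) = f v := by
  conv_rhs => rw [← sum_smul_stdVec v]
  simp [map_sum]

theorem differentiableAt_partialDeriv {f : Model m → ℝ} {y : Model m}
    (hf : ContDiffAt ℝ 2 f y) (k : Fin m) : DifferentiableAt ℝ (partialDeriv k f) y := by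
  have : ContDiffAt ℝ 1 (fderiv ℝ f) y := hf.fderiv_right (by norm_num)
  exact (this.differentiableAt (by norm_num)).clm_apply (differentiableAt_const _)

theorem differentiableAt_christoffel {g : Fin m → Fin m → Model m → ℝ} {y : Model m}
    (hg : ∀ i j, ContDiffAt ℝ 2 (g i j) y) (hdet : (Matrix.of fun i j => g i j y).det ≠ 0)
    (i j k : Fin m) : DifferentiableAt ℝ (christoffel g i j k) y := by
  have key : DifferentiableAt ℝ
      (fun z => ((fun i j => g i j z, fun i j k => partialDeriv k (g i j) z) :
        (Fin m → Fin m → ℝ) × (Fin m → Fin m → Fin m → ℝ))) y := by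
    refine DifferentiableAt.prodMk ?_ ?_
    · exact differentiableAt_pi.2 fun i => differentiableAt_pi.2 fun j =>
        (hg i j).differentiableAt (by norm_num)
    · exact differentiableAt_pi.2 fun i => differentiableAt_pi.2 fun j =>
        differentiableAt_pi.2 fun k => differentiableAt_partialDeriv (hg i j) k
  have h := (differentiableAt_christoffelAlg i j k
      (fun i j => g i j y, fun i j k => partialDeriv k (g i j) y) hdet).comp y key
  exact h

/-- Lowering the index of the Christoffel symbols. -/
theorem sum_christoffel_mul {g : Fin m → Fin m → Model m → ℝ} {y : Model m}
    (hdet : (Matrix.of fun i j => g i j y).det ≠ 0) (i j t : Fin m) :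
    ∑ k, christoffel g i j k y * g k t y =
      (1 / 2) * (partialDeriv i (g j t) y + partialDeriv j (g t i) y - partialDeriv t (g i j) y) := by
  set G : Matrix (Fin m) (Fin m) ℝ := Matrix.of fun i j => g i j y with hG
  have hinv : ∀ l, ∑ k, G⁻¹ l k * g k t y = if l = t then 1 else 0 := by
    intro l
    have := congrFun (congrFun (Matrix.nonsing_inv_mul G (isUnit_iff_ne_zero.2 hdet)) l) t
    rw [Matrix.mul_apply, Matrix.one_apply] at this
    exact this
  simp only [christoffel, ← hG, mul_assoc, Finset.sum_mul]
  rw [← Finset.mul_sum, Finset.sum_comm]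
  congr 1
  have : ∀ l, ∑ k, G⁻¹ l k *
      ((partialDeriv i (g j l) y + partialDeriv j (g l i) y - partialDeriv l (g i j) y) * g k t y) =
      (if l = t then 1 else 0) *
        (partialDeriv i (g j l) y + partialDeriv j (g l i) y - partialDeriv l (g i j) y) := by
    intro l
    rw [← hinv l, Finset.sum_mul]
    exact Finset.sum_congr rfl fun k _ => by ring
  simp [this]

theorem eventually_det_ne_zero {g : Fin m → Fin m → Model m → ℝ} {y : Model m}
    (hg : ∀ i j, ContinuousAt (g i j) y) (hdet : (Matrix.of fun i j => g i j y).det ≠ 0) :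
    ∀ᶠ z in 𝓝 y, (Matrix.of fun i j => g i j z).det ≠ 0 := by
  have hc : ContinuousAt (fun z => (Matrix.of fun i j => g i j z)) y :=
    continuousAt_pi.2 fun i => continuousAt_pi.2 fun j => hg i j
  have hc' : ContinuousAt (fun z => (Matrix.of fun i j => g i j z).det) y :=
    (continuous_id.matrix_det).continuousAt.comp hc
  exact hc'.eventually_ne hdet

/-- The derivative of the lowered Christoffel symbols. -/
theorem sum_partialDeriv_christoffel_mul {g : Fin m → Fin m → Model m → ℝ} {y : Model m}
    (hg : ∀ i j, ContDiffAt ℝ 2 (g i j) y) (hdet : (Matrix.of fun i j => g i j y).det ≠ 0)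
    (i j t x : Fin m) :
    ∑ k, partialDeriv x (christoffel g i j k) y * g k t y =
      (1 / 2) * (partialDeriv x (partialDeriv i (g j t)) y +
        partialDeriv x (partialDeriv j (g t i)) y - partialDeriv x (partialDeriv t (g i j)) y) -
      ∑ k, christoffel g i j k y * partialDeriv x (g k t) y := by
  -- Lowering the index is needed on a whole neighbourhood, since the identity is differentiated;
  -- this avoids differentiating the inverse matrix.
  have hev : (fun z => ∑ k, christoffel g i j k z * g k t z) =ᶠ[𝓝 y] fun z => (1 / 2) *
      (partialDeriv i (g j t) z + partialDeriv j (g t i) z - partialDeriv t (g i j) z) := by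
    filter_upwards [eventually_det_ne_zero (fun i j => (hg i j).continuousAt) hdet] with z hz
    exact sum_christoffel_mul hz i j t
  have hΓ := differentiableAt_christoffel hg hdet
  have hd : ∀ i j, DifferentiableAt ℝ (g i j) y := fun i j =>
    (hg i j).differentiableAt (by norm_num)
  have h1 := HasFDerivAt.fun_sum (u := Finset.univ) fun k _ =>
    (hΓ i j k).hasFDerivAt.mul (hd k t).hasFDerivAt
  have h2 := (((differentiableAt_partialDeriv (hg j t) i).hasFDerivAt.add
    (differentiableAt_partialDeriv (hg t i) j).hasFDerivAt).sub
    (differentiableAt_partialDeriv (hg i j) t).hasFDerivAt).const_mul (1 / 2 : ℝ)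
  have h := congrArg (fun L => L (stdVec x)) ((h1.congr_of_eventuallyEq hev.symm).unique h2)
  simp only [sum_apply, add_apply, smul_apply, sub_apply, smul_eq_mul, Finset.sum_add_distrib] at h
  simp only [partialDeriv] at h ⊢
  rw [← h]
  simp [mul_comm]

variable {a : ℝ} {B : Model m →L[ℝ] Model m →L[ℝ] ℝ} {Q : Model m →L[ℝ] Model m →L[ℝ] Model m}
  {C : Model m →L[ℝ] Model m →L[ℝ] Model m →L[ℝ] Model m}
  {g : Fin m → Fin m → Model m → ℝ} {y : Model m}

/-- A constant metric pulled back by `φ` has connection `(dφ)⁻¹ d²φ`, which is `Q` where `dφ = id`.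
The conformal factor is 1 to first order and does not contribute. -/
theorem christoffel_of_modelJet (hdet : (Matrix.of fun i j => g i j y).det ≠ 0)
    (hB : ∀ u v, B u v = B v u) (hQ : ∀ u v, Q u v = Q v u)
    (h : jetArrayAt g y = modelJet a B Q C) (i j k : Fin m) :
    christoffel g i j k y = Q (stdVec i) (stdVec j) k := by
  simp only [jetArrayAt, modelJet, Prod.mk.injEq] at h
  obtain ⟨h0, h1, -⟩ := h
  have h0' : ∀ i j, g i j y = B (stdVec i) (stdVec j) := fun i j => congrFun (congrFun h0 i) j
  have h1' := fun i j k => congrFun (congrFun (congrFun h1 i) j) k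
  set G : Matrix (Fin m) (Fin m) ℝ := Matrix.of fun i j => g i j y with hG
  have hinv : ∀ t, ∑ l, g t l y * G⁻¹ l k = if t = k then 1 else 0 := by
    intro t
    have := congrFun (congrFun (Matrix.mul_nonsing_inv G (isUnit_iff_ne_zero.2 hdet)) t) k
    rw [Matrix.mul_apply, Matrix.one_apply] at this
    exact this
  have hS : ∀ l, partialDeriv i (g j l) y + partialDeriv j (g l i) y - partialDeriv l (g i j) y =
      2 * ∑ t, Q (stdVec i) (stdVec j) t * g t l y := by
    intro l
    have e : ∑ t, Q (stdVec i) (stdVec j) t * g t l y = B (Q (stdVec i) (stdVec j)) (stdVec l) := by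
      have := sum_apply_stdVec (B.flip (stdVec l)) (Q (stdVec i) (stdVec j))
      simpa [h0'] using this
    -- Of the six terms `B(Q ·, ·)` in the Koszul combination, four cancel in pairs by symmetry and
    -- the other two are equal.
    rw [e, h1', h1', h1', hQ (stdVec j) (stdVec i),
      hQ (stdVec l) (stdVec i), hB (stdVec j), hB (stdVec l), hQ (stdVec j) (stdVec l),
      hB (stdVec i)]
    ring
  simp only [christoffel, ← hG, hS]
  calc (1 / 2) * ∑ l, G⁻¹ l k * (2 * ∑ t, Q (stdVec i) (stdVec j) t * g t l y)
      = ∑ l, ∑ t, Q (stdVec i) (stdVec j) t * (g t l y * G⁻¹ l k) := by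
        rw [Finset.mul_sum]
        refine Finset.sum_congr rfl fun l _ => ?_
        rw [show (1 / 2 : ℝ) * (G⁻¹ l k * (2 * ∑ t, Q (stdVec i) (stdVec j) t * g t l y)) =
          (∑ t, Q (stdVec i) (stdVec j) t * g t l y) * G⁻¹ l k by ring, Finset.sum_mul]
        exact Finset.sum_congr rfl fun t _ => by ring
    _ = Q (stdVec i) (stdVec j) k := by
        rw [Finset.sum_comm]
        simp only [← Finset.mul_sum, hinv]
        simp

/-- The lowered curvature tensor of a metric whose 2-jet is `modelJet a B Q C` is that of
constant curvature `a`. -/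
theorem sum_curvatureComponent_mul (hg : ∀ i j, ContDiffAt ℝ 2 (g i j) y)
    (hdet : (Matrix.of fun i j => g i j y).det ≠ 0)
    (hB : ∀ u v, B u v = B v u) (hQ : ∀ u v, Q u v = Q v u)
    (hC : ∀ u v w, C u v w = C v u w) (hC' : ∀ u v w, C u v w = C u w v)
    (h : jetArrayAt g y = modelJet a B Q C) (i j k s : Fin m) :
    ∑ l, curvatureComponent g i j k l y * g l s y =
      a * (B (stdVec i) (stdVec k) * B (stdVec j) (stdVec s) -
        B (stdVec j) (stdVec k) * B (stdVec i) (stdVec s)) := by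
  have hΓ := christoffel_of_modelJet hdet hB hQ h
  simp only [jetArrayAt, modelJet, Prod.mk.injEq] at h
  obtain ⟨h0, h1, h2⟩ := h
  have h0' : ∀ i j, g i j y = B (stdVec i) (stdVec j) := fun i j => congrFun (congrFun h0 i) j
  have h1' := fun i j k => congrFun (congrFun (congrFun h1 i) j) k
  have h2' := fun i j k l => congrFun (congrFun (congrFun (congrFun h2 i) j) k) l
  have hsum1 : ∀ (u x : Model m), ∑ l, u l * B (stdVec l) x = B u x := fun u x => by
    simpa using sum_apply_stdVec (B.flip x) u
  have hsum2 : ∀ (u z x : Model m), ∑ l, u l * B (Q z (stdVec l)) x = B (Q z u) x := fun u z x => by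
    simpa using sum_apply_stdVec ((B.flip x).comp (Q z)) u
  have hD : ∀ i j k, ∑ l, partialDeriv j (christoffel g i k l) y * g l s y = _ := fun i j k =>
    sum_partialDeriv_christoffel_mul hg hdet i k s j
  have hΓd : ∀ i j k, ∑ l, christoffel g i k l y * partialDeriv j (g l s) y =
      B (Q (stdVec j) (Q (stdVec i) (stdVec k))) (stdVec s) +
        B (Q (stdVec i) (stdVec k)) (Q (stdVec j) (stdVec s)) := by
    intro i j k
    simp only [hΓ, h1', mul_add, Finset.sum_add_distrib, hsum1, hsum2]
  have hΓΓ : ∀ i j k, ∑ l, (∑ t, christoffel g i k t y * christoffel g j t l y) * g l s y =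
      B (Q (stdVec j) (Q (stdVec i) (stdVec k))) (stdVec s) := by
    intro i j k
    simp only [hΓ, h0', Finset.sum_mul]
    rw [Finset.sum_comm]
    simp only [mul_assoc, ← Finset.mul_sum, hsum1, hsum2]
  have hsplit : ∑ l, curvatureComponent g i j k l y * g l s y =
      ∑ l, partialDeriv j (christoffel g i k l) y * g l s y -
      ∑ l, partialDeriv i (christoffel g j k l) y * g l s y +
      (∑ l, (∑ t, christoffel g i k t y * christoffel g j t l y) * g l s y -
        ∑ l, (∑ t, christoffel g j k t y * christoffel g i t l y) * g l s y) := by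
    simp only [curvatureComponent, ← Finset.sum_sub_distrib, ← Finset.sum_add_distrib]
    refine Finset.sum_congr rfl fun l _ => ?_
    rw [Finset.sum_sub_distrib]; ring
  rw [hsplit, hΓΓ, hΓΓ, hD, hD, hΓd, hΓd]
  simp only [h2']
  have c1 : ∀ p q r t : Fin m, B (stdVec p) (C (stdVec q) (stdVec r) (stdVec t)) =
      B (C (stdVec q) (stdVec r) (stdVec t)) (stdVec p) := fun _ _ _ _ => hB _ _
  have c2 : ∀ p q r t : Fin m, B (C (stdVec q) (stdVec r) (stdVec t)) (stdVec p) =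
      B (C (stdVec r) (stdVec q) (stdVec t)) (stdVec p) := fun _ _ _ _ => by rw [hC]
  have c3 : ∀ p q r t : Fin m, B (C (stdVec q) (stdVec r) (stdVec t)) (stdVec p) =
      B (C (stdVec q) (stdVec t) (stdVec r)) (stdVec p) := fun _ _ _ _ => by rw [hC']
  simp only [c1]
  -- The symmetries bring equal arguments of `C`, `Q` and `B` to the same order. Then the third
  -- derivatives cancel, the products `B(Q, Q)` from the second derivatives of the metric cancel
  -- those from `hΓd`, and only the terms with `a` remain.
  rw [c2 s j i k, c2 k j i s, c3 i j k s, c2 s j k i, c3 s k j i, c2 s k i j, c3 k j s i,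
    c2 k j i s, c3 k i s j, c3 j i k s, hQ (stdVec j) (stdVec i), hQ (stdVec k) (stdVec i),
    hQ (stdVec k) (stdVec j), hQ (stdVec s) (stdVec i), hQ (stdVec s) (stdVec j),
    hQ (stdVec k) (stdVec s), hB (stdVec s) (stdVec i), hB (stdVec k) (stdVec i),
    hB (stdVec k) (stdVec j), hB (stdVec s) (stdVec j), hB (stdVec i) (stdVec j),
    hB (Q (stdVec i) (stdVec s)) (Q (stdVec j) (stdVec k)),
    hB (Q (stdVec j) (stdVec s)) (Q (stdVec i) (stdVec k))]
  ring

theorem metricForm_eq (h : ∀ i j, g i j y = B (stdVec i) (stdVec j)) (v w : Model m) :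
    metricForm g y v w = B v w := by
  simp only [metricForm, h]
  rw [← B.flip_apply v w, ← sum_apply_stdVec (B.flip w) v]
  refine Finset.sum_congr rfl fun i _ => ?_
  rw [smul_eq_mul, ContinuousLinearMap.flip_apply, ← sum_apply_stdVec (B (stdVec i)) w,
    Finset.mul_sum]
  exact Finset.sum_congr rfl fun j _ => by rw [smul_eq_mul]; ring

theorem sum_four_mul (b : Fin m → Fin m → ℝ) (d : Fin m → Fin m → ℝ) (p q r t : Fin m → ℝ) :
    ∑ i, ∑ j, ∑ k, ∑ s, b i k * d j s * p i * q j * r k * t s =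
      (∑ i, ∑ k, b i k * p i * r k) * ∑ j, ∑ s, d j s * q j * t s := by
  rw [Finset.sum_mul]
  refine Finset.sum_congr rfl fun i _ => ?_
  rw [Finset.sum_comm, Finset.sum_mul]
  refine Finset.sum_congr rfl fun k _ => ?_
  rw [Finset.mul_sum]
  refine Finset.sum_congr rfl fun j _ => ?_
  rw [Finset.mul_sum]
  exact Finset.sum_congr rfl fun s _ => by ring

/-- Strict Cauchy–Schwarz: the nonzero vector `B(v,v) w - B(v,w) v` has square `B(v,v)` times the
asserted positive quantity. -/
theorem sq_lt_of_linearIndependent {E : Type*} [AddCommGroup E] [Module ℝ E] [TopologicalSpace E]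
    {B : E →L[ℝ] E →L[ℝ] ℝ} (hB : ∀ u v, B u v = B v u) (hpos : ∀ u, u ≠ 0 → 0 < B u u) {v w : E}
    (hvw : LinearIndependent ℝ ![v, w]) : 0 < B v v * B w w - B v w ^ 2 := by
  have hv : v ≠ 0 := hvw.ne_zero 0
  have hu : B v v • w - B v w • v ≠ 0 := by
    intro h0
    have := LinearIndependent.pair_iff.1 hvw (-B v w) (B v v) (by rw [← h0]; module)
    exact (hpos v hv).ne' this.2
  have h := hpos _ hu
  simp only [map_sub, map_smul, sub_apply, smul_apply, smul_eq_mul, hB w v] at h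
  have h' : 0 < B v v * (B v v * B w w - B v w ^ 2) := by nlinarith
  exact pos_of_mul_pos_right h' (hpos v hv).le

/-- A metric whose 2-jet is `modelJet a B Q C` has all sectional curvatures equal to `a`. -/
theorem coordSec_of_modelJet (hg : ∀ i j, ContDiffAt ℝ 2 (g i j) y)
    (hdet : (Matrix.of fun i j => g i j y).det ≠ 0)
    (hB : ∀ u v, B u v = B v u) (hpos : ∀ u, u ≠ 0 → 0 < B u u) (hQ : ∀ u v, Q u v = Q v u)
    (hC : ∀ u v w, C u v w = C v u w) (hC' : ∀ u v w, C u v w = C u w v)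
    (h : jetArrayAt g y = modelJet a B Q C) {v w : Model m}
    (hvw : LinearIndependent ℝ ![v, w]) : coordSec g y v w = a := by
  have h0 : ∀ i j, g i j y = B (stdVec i) (stdVec j) := fun i j =>
    congrFun (congrFun (congrArg Prod.fst h) i) j
  have hm := metricForm_eq h0
  have hcf : curvatureForm g y v w = a * (B v v * B w w - B v w ^ 2) := by
    simp only [curvatureForm, sum_curvatureComponent_mul hg hdet hB hQ hC hC' h]
    have e1 := sum_four_mul (fun i k => g i k y) (fun i k => g i k y) v w v w
    -- `e1` and `e2` separate the two products of the constant curvature tensor into products of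
    -- metric forms; together they give the Gram determinant.
    have e2 : ∑ i, ∑ j, ∑ k, ∑ s, g j k y * g i s y * v i * w j * v k * w s =
        metricForm g y w v * metricForm g y v w := by
      rw [Finset.sum_comm]
      rw [metricForm, metricForm, ← sum_four_mul]
      refine Finset.sum_congr rfl fun i _ => Finset.sum_congr rfl fun j _ =>
        Finset.sum_congr rfl fun k _ => Finset.sum_congr rfl fun s _ => by ring
    change _ = metricForm g y v v * metricForm g y w w at e1
    have e3 : a * (B v v * B w w - B v w ^ 2) = a * (metricForm g y v v * metricForm g y w w -
        metricForm g y w v * metricForm g y v w) := by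
      rw [hm, hm, hm, hm, hB w v]; ring
    rw [e3, ← e1, ← e2]
    simp only [← Finset.sum_sub_distrib, Finset.mul_sum, h0]
    refine Finset.sum_congr rfl fun i _ => Finset.sum_congr rfl fun j _ =>
        Finset.sum_congr rfl fun k _ => Finset.sum_congr rfl fun s _ => by ring
  have hne := (sq_lt_of_linearIndependent hB hpos hvw).ne'
  rw [coordSec, hcf, hm, hm, hm]
  exact mul_div_cancel_right₀ _ hne

end Curvature

/-! ### The 2-jet of the pulled-back metric in coordinates -/

section PulledBackMetric

variable {m : ℕ}

/-- The bilinear form `(1 - a/2 B(φ, φ)) B(dφ ·, dφ ·)`. -/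
def pullMetric (a : ℝ) (B : Model m →L[ℝ] Model m →L[ℝ] ℝ) (φ : Model m → Model m)
    (i j : Fin m) (y : Model m) : ℝ :=
  (1 - a / 2 * B (φ y) (φ y)) * B (fderiv ℝ φ y (stdVec i)) (fderiv ℝ φ y (stdVec j))

theorem partialDeriv_bilin {V W : Type*} [NormedAddCommGroup V] [NormedSpace ℝ V]
    [NormedAddCommGroup W] [NormedSpace ℝ W] (B : V →L[ℝ] W →L[ℝ] ℝ)
    {F : Model m → V} {G : Model m → W} {y : Model m} (hF : DifferentiableAt ℝ F y)
    (hG : DifferentiableAt ℝ G y) (k : Fin m) :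
    partialDeriv k (fun z => B (F z) (G z)) y =
      B (fderiv ℝ F y (stdVec k)) (G y) + B (F y) (fderiv ℝ G y (stdVec k)) := by
  have h := B.hasFDerivAt_of_bilinear hF.hasFDerivAt hG.hasFDerivAt
  rw [partialDeriv, h.fderiv]
  simp [add_comm]

theorem partialDeriv_mul {F G : Model m → ℝ} {y : Model m} (hF : DifferentiableAt ℝ F y)
    (hG : DifferentiableAt ℝ G y) (k : Fin m) :
    partialDeriv k (fun z => F z * G z) y =
      partialDeriv k F y * G y + F y * partialDeriv k G y := by
  simpa [partialDeriv] using partialDeriv_bilin (ContinuousLinearMap.mul ℝ ℝ) hF hG k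

theorem partialDeriv_add {F G : Model m → ℝ} {y : Model m} (hF : DifferentiableAt ℝ F y)
    (hG : DifferentiableAt ℝ G y) (k : Fin m) :
    partialDeriv k (fun z => F z + G z) y = partialDeriv k F y + partialDeriv k G y := by
  simp only [partialDeriv]
  rw [fderiv_fun_add hF hG]; rfl

theorem partialDeriv_one_sub {F : Model m → ℝ} {y : Model m} (c : ℝ)
    (hF : DifferentiableAt ℝ F y) (k : Fin m) :
    partialDeriv k (fun z => 1 - c * F z) y = -(c * partialDeriv k F y) := by
  simp only [partialDeriv]
  rw [fderiv_const_sub, fderiv_const_mul hF]; rfl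

theorem fderiv_clm_apply_const {V : Type*} [NormedAddCommGroup V] [NormedSpace ℝ V]
    {F : Model m → Model m →L[ℝ] V} {y : Model m} (hF : DifferentiableAt ℝ F y) (u w : Model m) :
    fderiv ℝ (fun z => F z u) y w = fderiv ℝ F y w u := by
  rw [fderiv_clm_apply hF (differentiableAt_const _)]
  simp

variable {φ : Model m → Model m} {y : Model m}

/-- No normalization of `φ` at `y` is assumed, so that the formula is also available at nearby
points and can be differentiated once more. -/
theorem partialDeriv_pullMetric (a : ℝ) (B : Model m →L[ℝ] Model m →L[ℝ] ℝ)
    (hφ : ContDiffAt ℝ 2 φ y) (i j k : Fin m) :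
    partialDeriv k (pullMetric a B φ i j) y =
      -(a / 2 * (B (fderiv ℝ φ y (stdVec k)) (φ y) + B (φ y) (fderiv ℝ φ y (stdVec k)))) *
        B (fderiv ℝ φ y (stdVec i)) (fderiv ℝ φ y (stdVec j)) +
      (1 - a / 2 * B (φ y) (φ y)) *
        (B (fderiv ℝ (fderiv ℝ φ) y (stdVec k) (stdVec i)) (fderiv ℝ φ y (stdVec j)) +
          B (fderiv ℝ φ y (stdVec i)) (fderiv ℝ (fderiv ℝ φ) y (stdVec k) (stdVec j))) := by
  have h0 : DifferentiableAt ℝ φ y := hφ.differentiableAt (by norm_num)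
  have h1 : DifferentiableAt ℝ (fderiv ℝ φ) y :=
    (hφ.fderiv_right (m := 1) (by norm_num)).differentiableAt (by norm_num)
  have hB0 : DifferentiableAt ℝ (fun z => B (φ z) (φ z)) y := by fun_prop
  have hB1 : DifferentiableAt ℝ
      (fun z => B (fderiv ℝ φ z (stdVec i)) (fderiv ℝ φ z (stdVec j))) y := by fun_prop
  unfold pullMetric
  rw [partialDeriv_mul ((hB0.const_mul _).const_sub _) hB1, partialDeriv_one_sub _ hB0,
    partialDeriv_bilin B h0 h0, partialDeriv_bilin B (by fun_prop) (by fun_prop),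
    fderiv_clm_apply_const h1, fderiv_clm_apply_const h1]

-- Because `φ` vanishes at `y`, the conformal factor has value 1 and zero first derivative there;
-- its second derivative supplies the term with `a`. All remaining terms are the product rule
-- applied to `B(dφ, dφ)` with `dφ = id` inserted at the end.
set_option maxSynthPendingDepth 3 in
theorem jetArrayAt_pullMetric (a : ℝ) {B : Model m →L[ℝ] Model m →L[ℝ] ℝ}
    (hB : ∀ u v, B u v = B v u) (hφ : ContDiffAt ℝ 3 φ y) (hφ0 : φ y = 0)
    (hφ1 : fderiv ℝ φ y = ContinuousLinearMap.id ℝ (Model m)) :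
    jetArrayAt (pullMetric a B φ) y =
      modelJet a B (fderiv ℝ (fderiv ℝ φ) y) (fderiv ℝ (fderiv ℝ (fderiv ℝ φ)) y) := by
  have hφ2 : ContDiffAt ℝ 2 φ y := hφ.of_le (by norm_num)
  have h0 : DifferentiableAt ℝ φ y := hφ.differentiableAt (by norm_num)
  have h1 : DifferentiableAt ℝ (fderiv ℝ φ) y :=
    (hφ.fderiv_right (m := 2) (by norm_num)).differentiableAt (by norm_num)
  have h2 : DifferentiableAt ℝ (fderiv ℝ (fderiv ℝ φ)) y :=
    ((hφ.fderiv_right (m := 2) (by norm_num)).fderiv_right (m := 1)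
      (by norm_num)).differentiableAt (by norm_num)
  have hev : ∀ᶠ z in 𝓝 y, ContDiffAt ℝ 2 φ z := hφ2.eventually (by simp)
  refine Prod.ext ?_ (Prod.ext ?_ ?_)
  · funext i j
    simp [jetArrayAt, modelJet, pullMetric, hφ0, hφ1]
  · funext i j k
    simp [jetArrayAt, modelJet, partialDeriv_pullMetric a B hφ2, hφ0, hφ1]
  · funext i j k l
    have he : partialDeriv k (pullMetric a B φ i j) =ᶠ[𝓝 y] _ :=
      hev.mono fun z hz => partialDeriv_pullMetric a B hz i j k
    simp only [jetArrayAt, modelJet]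
    rw [partialDeriv, he.fderiv_eq]
    change partialDeriv l _ y = _
    have hb1 : ∀ i, DifferentiableAt ℝ (fun z => fderiv ℝ φ z (stdVec i)) y := fun i => by fun_prop
    have hb2 : ∀ i k, DifferentiableAt ℝ
      (fun z => fderiv ℝ (fderiv ℝ φ) z (stdVec i) (stdVec k)) y := fun i k => by fun_prop
    have hd2 : ∀ i k, fderiv ℝ (fun z => fderiv ℝ (fderiv ℝ φ) z (stdVec i) (stdVec k)) y
        (stdVec l) = fderiv ℝ (fderiv ℝ (fderiv ℝ φ)) y (stdVec l) (stdVec i) (stdVec k) := by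
      intro i k
      rw [fderiv_clm_apply_const (F := fun z => fderiv ℝ (fderiv ℝ φ) z (stdVec i))
        (by fun_prop), fderiv_clm_apply_const h2]
    -- Only the terms in which the undifferentiated factor `φ` is differentiated survive at `y`.
    -- There are two equal ones, which turns `a / 2` into `a`.
    have hn : partialDeriv l (fun z => -(a / 2 * (B (fderiv ℝ φ z (stdVec k)) (φ z) +
        B (φ z) (fderiv ℝ φ z (stdVec k))))) y = -(a * B (stdVec k) (stdVec l)) := by
      rw [partialDeriv, fderiv_fun_neg, fderiv_const_mul (by fun_prop)]
      change -(a / 2 * partialDeriv l _ y) = _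
      rw [partialDeriv_add (by fun_prop) (by fun_prop),
        partialDeriv_bilin B (hb1 k) h0, partialDeriv_bilin B h0 (hb1 k),
        hφ0, hφ1]
      simp [hB (stdVec l)]
      ring
    rw [partialDeriv_add (by fun_prop) (by fun_prop), partialDeriv_mul (by fun_prop) (by fun_prop),
      partialDeriv_mul (by fun_prop) (by fun_prop), hn, partialDeriv_one_sub _ (by fun_prop),
      partialDeriv_add (by fun_prop) (by fun_prop), partialDeriv_bilin B h0 h0,
      partialDeriv_bilin B (hb2 k i) (hb1 j), partialDeriv_bilin B (hb1 i) (hb2 k j),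
      hd2, hd2, fderiv_clm_apply_const h1, fderiv_clm_apply_const h1, hφ0, hφ1]
    simp
    ring

/-- Symmetry of the third derivative. -/
theorem fderiv_fderiv_fderiv_symm {E F : Type*} [NormedAddCommGroup E] [NormedSpace ℝ E]
    [NormedAddCommGroup F] [NormedSpace ℝ F] {f : E → F} {y : E} (hf : ContDiffAt ℝ 3 f y) :
    (∀ u v w, fderiv ℝ (fderiv ℝ (fderiv ℝ f)) y u v w =
      fderiv ℝ (fderiv ℝ (fderiv ℝ f)) y v u w) ∧
    ∀ u v w, fderiv ℝ (fderiv ℝ (fderiv ℝ f)) y u v w =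
      fderiv ℝ (fderiv ℝ (fderiv ℝ f)) y u w v := by
  have h1 : ContDiffAt ℝ 2 (fderiv ℝ f) y := hf.fderiv_right (by norm_num)
  have h2 : DifferentiableAt ℝ (fderiv ℝ (fderiv ℝ f)) y :=
    (h1.fderiv_right (m := 1) (by norm_num)).differentiableAt (by norm_num)
  refine ⟨fun u v w => ?_, fun u v w => ?_⟩
  · have := h1.isSymmSndFDerivAt (by simp)
    rw [this.eq u v]
  -- For the last two arguments, the symmetry of the second derivative holds near `y` and is
  -- differentiated.
  · have hev : ∀ᶠ z in 𝓝 y, ContDiffAt ℝ 2 f z := (hf.of_le (by norm_num)).eventually (by simp)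
    have hs : (fun z => fderiv ℝ (fderiv ℝ f) z v w) =ᶠ[𝓝 y]
        fun z => fderiv ℝ (fderiv ℝ f) z w v := hev.mono fun z hz =>
      (hz.isSymmSndFDerivAt (by simp)).eq v w
    have key : ∀ v w, fderiv ℝ (fun z => fderiv ℝ (fderiv ℝ f) z v w) y u =
        fderiv ℝ (fderiv ℝ (fderiv ℝ f)) y u v w := by
      intro v w
      have := (h2.hasFDerivAt.clm_apply (hasFDerivAt_const v y)).clm_apply (hasFDerivAt_const w y)
      rw [this.fderiv]; simp
    rw [← key, ← key, hs.fderiv_eq]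

end PulledBackMetric

/-! ### From a coordinate system on the manifold to a local metric -/

section PulledBackLocalMetric

variable {m : ℕ} {M : Type*} [TopologicalSpace M] [ChartedSpace (Model m) M]

/-- The bilinear form `(1 - a/2 B(ψ, ψ)) B(dψ ·, dψ ·)` on the tangent spaces of `M`. -/
def pullForm (a : ℝ) (B : Model m →L[ℝ] Model m →L[ℝ] ℝ) (ψ : M → Model m) (x : M) :
    TangentSpace 𝓘(ℝ, Model m) x →L[ℝ] TangentSpace 𝓘(ℝ, Model m) x →L[ℝ] ℝ :=
  let D : TangentSpace 𝓘(ℝ, Model m) x →L[ℝ] Model m := mfderiv 𝓘(ℝ, Model m) 𝓘(ℝ, Model m) ψ x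
  (1 - a / 2 * B (ψ x) (ψ x)) • (ContinuousLinearMap.precomp ℝ D ∘L B ∘L D)

theorem pullForm_apply (a : ℝ) (B : Model m →L[ℝ] Model m →L[ℝ] ℝ) (ψ : M → Model m) (x : M)
    (u v : TangentSpace 𝓘(ℝ, Model m) x) :
    pullForm a B ψ x u v = (1 - a / 2 * B (ψ x) (ψ x)) *
      B (mfderiv 𝓘(ℝ, Model m) 𝓘(ℝ, Model m) ψ x u)
        (mfderiv 𝓘(ℝ, Model m) 𝓘(ℝ, Model m) ψ x v) := rfl

theorem contDiff_bilinearComp_self (B : Model m →L[ℝ] Model m →L[ℝ] ℝ) :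
    ContDiff ℝ ∞ (fun A : Model m →L[ℝ] Model m => B.bilinearComp A A) := by
  rw [contDiff_clm_apply_iff]
  intro u
  rw [contDiff_clm_apply_iff]
  intro v
  simp only [ContinuousLinearMap.bilinearComp_apply]
  fun_prop

theorem fderiv_comp_symm_apply {ψ : M → Model m} {e : OpenPartialHomeomorph M (Model m)}
    (he : e ∈ charts m M) {y : Model m} (hy : y ∈ e.target)
    (hψ : MDifferentiableAt 𝓘(ℝ, Model m) 𝓘(ℝ, Model m) ψ (e.symm y)) (v : Model m) :
    fderiv ℝ (ψ ∘ e.symm) y v = mfderiv 𝓘(ℝ, Model m) 𝓘(ℝ, Model m) ψ (e.symm y)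
      (mfderiv 𝓘(ℝ, Model m) 𝓘(ℝ, Model m) e.symm y v) := by
  have hsymm : ContMDiffAt 𝓘(ℝ, Model m) 𝓘(ℝ, Model m) ∞ e.symm y :=
    (contMDiffOn_symm_of_mem_maximalAtlas he).contMDiffAt (e.open_target.mem_nhds hy)
  rw [← mfderiv_eq_fderiv, mfderiv_comp y hψ (hsymm.mdifferentiableAt (by simp))]
  rfl

/-- Invertibility is tested in one fixed chart, where the derivatives at different points lie in one
algebra whose units form an open set; injectivity on the tangent spaces follows by the chain rule.
-/
theorem mfderiv_injective_of_isUnit {ψ : M → Model m} {e : OpenPartialHomeomorph M (Model m)}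
    (he : e ∈ charts m M) {x : M} (hx : x ∈ e.source)
    (hψ : MDifferentiableAt 𝓘(ℝ, Model m) 𝓘(ℝ, Model m) ψ x)
    (hu : IsUnit (fderiv ℝ (ψ ∘ e.symm) (e x))) :
    Function.Injective (mfderiv 𝓘(ℝ, Model m) 𝓘(ℝ, Model m) ψ x) := by
  have hd : e.MDifferentiable 𝓘(ℝ, Model m) 𝓘(ℝ, Model m) :=
    ⟨(contMDiffOn_of_mem_maximalAtlas he).mdifferentiableOn (by simp),
      (contMDiffOn_symm_of_mem_maximalAtlas he).mdifferentiableOn (by simp)⟩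
  have hinj : Function.Injective (fderiv ℝ (ψ ∘ e.symm) (e x)) := by
    obtain ⟨A, hA⟩ := hu
    rw [← hA]
    intro u v huv
    have h : ∀ w, A.inv (A.val w) = w := fun w =>
      congrArg (fun L : Model m →L[ℝ] Model m => L w) A.inv_val
    rw [← h u, ← h v]
    exact congrArg A.inv huv
  have key : ∀ u, mfderiv 𝓘(ℝ, Model m) 𝓘(ℝ, Model m) ψ x u =
      fderiv ℝ (ψ ∘ e.symm) (e x) (mfderiv 𝓘(ℝ, Model m) 𝓘(ℝ, Model m) e x u) := by
    intro u
    have h1 := fderiv_comp_symm_apply (ψ := ψ) he (e.map_source hx) (by rwa [e.left_inv hx])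
      (mfderiv 𝓘(ℝ, Model m) 𝓘(ℝ, Model m) e x u)
    have h2 := congrArg (fun L => L u) (hd.symm_comp_deriv hx)
    simp only [ContinuousLinearMap.comp_apply] at h2
    rw [h1]
    erw [h2]
    rw [e.left_inv hx]
    rfl
  intro u v huv
  rw [key, key] at huv
  exact hd.mfderiv_injective hx (hinj huv)

variable [IsManifold 𝓘(ℝ, Model m) ∞ M]

/-- In the trivialization of the tangent bundle around `x₀` the form becomes a smooth function times
`B(A ·, A ·)`, where `A` is `dψ` in tangent coordinates and depends smoothly on the point. -/
theorem contMDiffAt_pullForm (a : ℝ) (B : Model m →L[ℝ] Model m →L[ℝ] ℝ) {ψ : M → Model m} {x₀ : M}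
    (hψ : ContMDiffAt 𝓘(ℝ, Model m) 𝓘(ℝ, Model m) ∞ ψ x₀) :
    ContMDiffAt 𝓘(ℝ, Model m) (𝓘(ℝ, Model m).prod 𝓘(ℝ, Model m →L[ℝ] Model m →L[ℝ] ℝ)) ∞
    (fun x => TotalSpace.mk' (Model m →L[ℝ] Model m →L[ℝ] ℝ)
      (E := fun x : M => TangentSpace 𝓘(ℝ, Model m) x →L[ℝ] TangentSpace 𝓘(ℝ, Model m) x →L[ℝ] ℝ)
      x (pullForm a B ψ x)) x₀ := by
  have hA : ContMDiffAt 𝓘(ℝ, Model m) 𝓘(ℝ, Model m →L[ℝ] Model m) ∞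
      (inTangentCoordinates 𝓘(ℝ, Model m) 𝓘(ℝ, Model m) id ψ
        (mfderiv 𝓘(ℝ, Model m) 𝓘(ℝ, Model m) ψ) x₀) x₀ := hψ.mfderiv_const (by simp)
  have hs : ContMDiffAt 𝓘(ℝ, Model m) 𝓘(ℝ) ∞ (fun x => 1 - a / 2 * B (ψ x) (ψ x)) x₀ := by
    have : ContDiff ℝ ∞ (fun z : Model m => 1 - a / 2 * B z z) := by fun_prop
    exact this.contMDiff.contMDiffAt.comp x₀ hψ
  have hβ := (contDiff_bilinearComp_self B).contMDiff.contMDiffAt.comp x₀ hA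
  refine (contMDiffAt_hom_bundle _).2 ⟨contMDiffAt_id, (hs.smul hβ).congr_of_eventuallyEq ?_⟩
  filter_upwards [(chartAt (Model m) x₀).open_source.mem_nhds (mem_chart_source _ x₀)] with x hx
  have hx' : x ∈ (trivializationAt (Model m) (TangentSpace 𝓘(ℝ, Model m)) x₀).baseSet := by
    simpa using hx
  ext u v
  rw [inCoordinates_apply_eq₂ (F₃ := ℝ) (E₃ := Bundle.Trivial M ℝ) hx' hx' (mem_univ _)]
  have hAx : ∀ u, inTangentCoordinates 𝓘(ℝ, Model m) 𝓘(ℝ, Model m) id ψ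
        (mfderiv 𝓘(ℝ, Model m) 𝓘(ℝ, Model m) ψ) x₀ x u =
      mfderiv 𝓘(ℝ, Model m) 𝓘(ℝ, Model m) ψ x
        ((trivializationAt (Model m) (TangentSpace 𝓘(ℝ, Model m)) x₀).symm x u) := by
    intro u
    simp only [inTangentCoordinates, ContinuousLinearMap.inCoordinates, id, TangentBundle.continuousLinearMapAt_model_space]
    change mfderiv 𝓘(ℝ, Model m) 𝓘(ℝ, Model m) ψ x (Trivialization.symmL ℝ
      (trivializationAt (Model m) (TangentSpace 𝓘(ℝ, Model m)) x₀) x u) = _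
    rw [Trivialization.symmL_apply]
    exact hx'
  have hR : ((fun x => 1 - a / 2 * B (ψ x) (ψ x)) • ((fun A : Model m →L[ℝ] Model m =>
      B.bilinearComp A A) ∘ inTangentCoordinates 𝓘(ℝ, Model m) 𝓘(ℝ, Model m) id ψ
        (mfderiv 𝓘(ℝ, Model m) 𝓘(ℝ, Model m) ψ) x₀)) x u v =
      (1 - a / 2 * B (ψ x) (ψ x)) * B (inTangentCoordinates 𝓘(ℝ, Model m) 𝓘(ℝ, Model m) id ψ
        (mfderiv 𝓘(ℝ, Model m) 𝓘(ℝ, Model m) ψ) x₀ x u)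
        (inTangentCoordinates 𝓘(ℝ, Model m) 𝓘(ℝ, Model m) id ψ
        (mfderiv 𝓘(ℝ, Model m) 𝓘(ℝ, Model m) ψ) x₀ x v) := rfl
  refine Eq.trans ?_ hR.symm
  rw [hAx, hAx]
  simp
  rfl

/-- A coordinate system `ψ` around `p` and a scalar product `B` define a local metric. -/
theorem exists_localMetric_pullMetric (a : ℝ) {B : Model m →L[ℝ] Model m →L[ℝ] ℝ}
    (hB : ∀ u v, B u v = B v u) (hpos : ∀ u, u ≠ 0 → 0 < B u u) {ψ : M → Model m} {p : M}
    {U : Set M} (hU : IsOpen U) (hp : p ∈ U)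
    (hψ : ContMDiffOn 𝓘(ℝ, Model m) 𝓘(ℝ, Model m) ∞ ψ U) (hψ0 : ψ p = 0)
    {c : OpenPartialHomeomorph M (Model m)} (hc : c ∈ charts m M) (hpc : p ∈ c.source)
    (hψ1 : IsUnit (fderiv ℝ (ψ ∘ c.symm) (c p))) :
    ∃ g : LocalMetric m M, g.base = p ∧ ∀ e ∈ charts m M, p ∈ e.source → ∀ i j,
      g.component e i j =ᶠ[𝓝 (e p)] pullMetric a B (ψ ∘ e.symm) i j := by
  have hψAt : ∀ x ∈ U, ContMDiffAt 𝓘(ℝ, Model m) 𝓘(ℝ, Model m) ∞ ψ x := fun x hx =>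
    hψ.contMDiffAt (hU.mem_nhds hx)
  -- Away from `p` the conformal factor may become nonpositive and `dψ` may degenerate. Both
  -- defining conditions are open and hold at `p`, so the interior of `S` is a suitable domain.
  set S : Set M := {x | x ∈ U ∧ x ∈ c.source ∧ 0 < 1 - a / 2 * B (ψ x) (ψ x) ∧
    IsUnit (fderiv ℝ (ψ ∘ c.symm) (c x))} with hS
  have hpS : S ∈ 𝓝 p := by
    have h1 : ContinuousAt (fun x => 1 - a / 2 * B (ψ x) (ψ x)) p := by
      have : Continuous (fun z : Model m => 1 - a / 2 * B z z) := by fun_prop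
      exact this.continuousAt.comp (hψAt p hp).continuousAt
    have h2 : ContinuousAt (fun x => fderiv ℝ (ψ ∘ c.symm) (c x)) p := by
      have hs : ContMDiffAt 𝓘(ℝ, Model m) 𝓘(ℝ, Model m) ∞ c.symm (c p) :=
        (contMDiffOn_symm_of_mem_maximalAtlas hc).contMDiffAt
          (c.open_target.mem_nhds (c.map_source hpc))
      have h3 : ContDiffAt ℝ ∞ (ψ ∘ c.symm) (c p) :=
        (ContMDiffAt.comp_of_eq (hψAt p hp) hs (c.left_inv hpc)).contDiffAt
      have h4 : ContDiffAt ℝ 1 (fderiv ℝ (ψ ∘ c.symm)) (c p) := h3.fderiv_right (by norm_cast)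
      exact ContinuousAt.comp (f := c) h4.continuousAt (c.continuousAt hpc)
    filter_upwards [hU.mem_nhds hp, c.open_source.mem_nhds hpc,
      h1.eventually (lt_mem_nhds (a := 0) (by simp [hψ0])),
      h2.eventually (Units.isOpen.mem_nhds hψ1)] with x a1 a2 a3 a4
    exact ⟨a1, a2, a3, a4⟩
  have hinj : ∀ x ∈ interior S,
      Function.Injective (mfderiv 𝓘(ℝ, Model m) 𝓘(ℝ, Model m) ψ x) := by
    intro x hx
    obtain ⟨a1, a2, -, a4⟩ := interior_subset hx
    exact mfderiv_injective_of_isUnit hc a2 ((hψAt x a1).mdifferentiableAt (by simp)) a4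
  refine ⟨{ base := p
            dom := interior S
            isOpen_dom := isOpen_interior
            base_mem := mem_interior_iff_mem_nhds.2 hpS
            inner := pullForm a B ψ
            symm := fun x _ v w => ?_
            pos := fun x hx v hv => ?_
            contMDiffOn := fun x hx => ?_ }, rfl, ?_⟩
  · rw [pullForm_apply, pullForm_apply]
    exact congrArg _ (hB _ _)
  · rw [pullForm_apply]
    refine mul_pos (interior_subset hx).2.2.1 (hpos _ fun h0 => hv (hinj x hx ?_))
    rw [map_zero]; exact h0
  · exact (contMDiffAt_pullForm a B (hψAt x (interior_subset hx).1)).contMDiffWithinAt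
  · intro e he hpe i j
    have hcont : ContinuousAt e.symm (e p) := e.continuousAt_symm (e.map_source hpe)
    have : ∀ᶠ y in 𝓝 (e p), e.symm y ∈ U := hcont.eventually
      (by rw [e.left_inv hpe]; exact hU.mem_nhds hp)
    filter_upwards [this, e.open_target.mem_nhds (e.map_source hpe)] with y hyU hy
    have hd := fderiv_comp_symm_apply he hy ((hψAt _ hyU).mdifferentiableAt (by simp))
    simp only [LocalMetric.component, pullForm_apply, pullMetric, Function.comp_apply]
    rw [hd, hd]

end PulledBackLocalMetric

end CurvatureRelation

end

noncomputable section

set_option maxSynthPendingDepth 3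

namespace CurvatureRelation

/-! ### Transition maps and their derivatives -/

section Transition

variable {m : ℕ} {M : Type*} [TopologicalSpace M]
  {c d e : OpenPartialHomeomorph M (Model m)} {p : M}

theorem fderiv_transition_self (hpe : p ∈ e.source) :
    fderiv ℝ (e ∘ e.symm) (e p) = ContinuousLinearMap.id ℝ (Model m) := by
  rw [← fderiv_id (x := e p)]
  refine Filter.EventuallyEq.fderiv_eq ?_
  filter_upwards [e.open_target.mem_nhds (e.map_source hpe)] with y hy using e.right_inv hy

variable [ChartedSpace (Model m) M]

theorem contDiffAt_transition (he : e ∈ charts m M) (hd : d ∈ charts m M) (hpe : p ∈ e.source)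
    (hpd : p ∈ d.source) : ContDiffAt ℝ ∞ (d ∘ e.symm) (e p) := by
  have h1 : ContMDiffAt 𝓘(ℝ, Model m) 𝓘(ℝ, Model m) ∞ e.symm (e p) :=
    (contMDiffOn_symm_of_mem_maximalAtlas he).contMDiffAt
      (e.open_target.mem_nhds (e.map_source hpe))
  exact (ContMDiffAt.comp_of_eq (contMDiffAt_of_mem_maximalAtlas hd hpd) h1
    (e.left_inv hpe)).contDiffAt

/-- Cocycle rule for the derivatives at `p`, the source of all comparisons between charts below. -/
theorem fderiv_transition_comp (he : e ∈ charts m M) (hd : d ∈ charts m M) (hc : c ∈ charts m M)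
    (hpe : p ∈ e.source) (hpd : p ∈ d.source) (hpc : p ∈ c.source) :
    fderiv ℝ (e ∘ c.symm) (c p) ∘L fderiv ℝ (c ∘ d.symm) (d p) = fderiv ℝ (e ∘ d.symm) (d p) := by
  have h1 : DifferentiableAt ℝ (e ∘ c.symm) ((c ∘ d.symm) (d p)) := by
    simp only [Function.comp_apply, d.left_inv hpd]
    exact (contDiffAt_transition hc he hpc hpe).differentiableAt (by simp)
  have h2 := fderiv_comp (d p) h1
    ((contDiffAt_transition hd hc hpd hpc).differentiableAt (by simp))
  simp only [Function.comp_apply, d.left_inv hpd] at h2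
  rw [← h2]
  refine Filter.EventuallyEq.fderiv_eq ?_
  have hev : ∀ᶠ y in 𝓝 (d p), d.symm y ∈ c.source :=
    (d.continuousAt_symm (d.map_source hpd)).eventually
      (by rw [d.left_inv hpd]; exact c.open_source.mem_nhds hpc)
  filter_upwards [hev] with y hy
  simp [c.left_inv hy]

theorem continuousAt_fderiv_transition (he : e ∈ charts m M) (hd : d ∈ charts m M)
    (hpe : p ∈ e.source) (hpd : p ∈ d.source) :
    ContinuousAt (fun x => fderiv ℝ (d ∘ e.symm) (e x)) p ∧
    ContinuousAt (fun x => fderiv ℝ (fderiv ℝ (d ∘ e.symm)) (e x)) p ∧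
    ContinuousAt (fun x => fderiv ℝ (fderiv ℝ (fderiv ℝ (d ∘ e.symm))) (e x)) p := by
  have h := contDiffAt_transition he hd hpe hpd
  have h1 : ContDiffAt ℝ 3 (fderiv ℝ (d ∘ e.symm)) (e p) := h.fderiv_right (by norm_cast)
  have h2 : ContDiffAt ℝ 2 (fderiv ℝ (fderiv ℝ (d ∘ e.symm))) (e p) := h1.fderiv_right (by norm_num)
  have h3 : ContDiffAt ℝ 1 (fderiv ℝ (fderiv ℝ (fderiv ℝ (d ∘ e.symm)))) (e p) :=
    h2.fderiv_right (by norm_num)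
  exact ⟨ContinuousAt.comp (f := e) h1.continuousAt (e.continuousAt hpe),
    ContinuousAt.comp (f := e) h2.continuousAt (e.continuousAt hpe),
    ContinuousAt.comp (f := e) h3.continuousAt (e.continuousAt hpe)⟩

end Transition

/-! ### Derivatives of weighted sums and continuity of the model jet -/

/-- Derivative of a linear combination, in a form that can be iterated. -/
theorem fderiv_sum_smul_clm {ι E F G : Type*} [NormedAddCommGroup E] [NormedSpace ℝ E]
    [NormedAddCommGroup F] [NormedSpace ℝ F] [NormedAddCommGroup G] [NormedSpace ℝ G]
    (I : Finset ι) (w : ι → ℝ) (A : ι → F →L[ℝ] G) (f : ι → E → F) {y : E}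
    (hf : ∀ i ∈ I, ContDiffAt ℝ 1 (f i) y) :
    fderiv ℝ (fun z => ∑ i ∈ I, w i • A i (f i z)) =ᶠ[𝓝 y]
      fun z => ∑ i ∈ I, w i • ContinuousLinearMap.compL ℝ E F G (A i) (fderiv ℝ (f i) z) := by
  have hev : ∀ᶠ z in 𝓝 y, ∀ i ∈ I, ContDiffAt ℝ 1 (f i) z :=
    (Filter.eventually_all_finset I).2 fun i hi => (hf i hi).eventually (by simp)
  filter_upwards [hev] with z hz
  exact (HasFDerivAt.fun_sum fun i hi => (((A i).hasFDerivAt.comp z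
    ((hz i hi).differentiableAt (by simp)).hasFDerivAt).const_smul (w i))).fderiv

section PostComposition

variable {E F G : Type*} [NormedAddCommGroup E] [NormedSpace ℝ E]
  [NormedAddCommGroup F] [NormedSpace ℝ F] [NormedAddCommGroup G] [NormedSpace ℝ G]

/-- The bilinear map `(u, v) ↦ A (Q u v)`. -/
def postBilinear (A : F →L[ℝ] G) (Q : E →L[ℝ] E →L[ℝ] F) : E →L[ℝ] E →L[ℝ] G :=
  ContinuousLinearMap.compL ℝ E (E →L[ℝ] F) (E →L[ℝ] G) (ContinuousLinearMap.compL ℝ E F G A) Q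

/-- The trilinear map `(u, v, w) ↦ A (C u v w)`. -/
def postTrilinear (A : F →L[ℝ] G) (C : E →L[ℝ] E →L[ℝ] E →L[ℝ] F) :
    E →L[ℝ] E →L[ℝ] E →L[ℝ] G :=
  ContinuousLinearMap.compL ℝ E (E →L[ℝ] E →L[ℝ] F) (E →L[ℝ] E →L[ℝ] G)
    (ContinuousLinearMap.compL ℝ E (E →L[ℝ] F) (E →L[ℝ] G) (ContinuousLinearMap.compL ℝ E F G A)) C

variable {X : Type*} [TopologicalSpace X] {p : X} {A : X → F →L[ℝ] G}

theorem continuousAt_compL (hA : ContinuousAt A p) :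
    ContinuousAt (fun x => ContinuousLinearMap.compL ℝ E F G (A x)) p :=
  (ContinuousLinearMap.compL ℝ E F G).continuous.continuousAt.comp hA

theorem continuousAt_postBilinear {Q : X → E →L[ℝ] E →L[ℝ] F} (hA : ContinuousAt A p)
    (hQ : ContinuousAt Q p) : ContinuousAt (fun x => postBilinear (A x) (Q x)) p :=
  (continuousAt_compL (continuousAt_compL hA)).clm_apply hQ

theorem continuousAt_postTrilinear {C : X → E →L[ℝ] E →L[ℝ] E →L[ℝ] F} (hA : ContinuousAt A p)
    (hC : ContinuousAt C p) : ContinuousAt (fun x => postTrilinear (A x) (C x)) p :=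
  (continuousAt_compL (continuousAt_compL (continuousAt_compL hA))).clm_apply hC

/-- The first three derivatives of a linear combination of linear images. -/
theorem fderiv_iterated_sum_smul_clm {ι : Type*}
    (I : Finset ι) (w : ι → ℝ) (A : ι → F →L[ℝ] G) (f : ι → E → F) (k : ι → F) {y : E}
    (hf : ∀ i ∈ I, ContDiffAt ℝ 3 (f i) y) {φ : E → G}
    (hφ : ∀ z, φ z = ∑ i ∈ I, w i • A i (f i z - k i)) :
    fderiv ℝ φ y = ∑ i ∈ I, w i • (A i ∘L fderiv ℝ (f i) y) ∧
    fderiv ℝ (fderiv ℝ φ) y =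
      ∑ i ∈ I, w i • postBilinear (A i) (fderiv ℝ (fderiv ℝ (f i)) y) ∧
    fderiv ℝ (fderiv ℝ (fderiv ℝ φ)) y =
      ∑ i ∈ I, w i • postTrilinear (A i) (fderiv ℝ (fderiv ℝ (fderiv ℝ (f i))) y) := by
  obtain rfl : φ = fun z => ∑ i ∈ I, w i • A i (f i z - k i) := funext hφ
  have h1 : ∀ i ∈ I, ContDiffAt ℝ 2 (fderiv ℝ (f i)) y := fun i hi =>
    (hf i hi).fderiv_right (by norm_num)
  have h2 : ∀ i ∈ I, ContDiffAt ℝ 1 (fderiv ℝ (fderiv ℝ (f i))) y := fun i hi =>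
    (h1 i hi).fderiv_right (by norm_num)
  -- Each equality holds near `y` and its right side is again a weighted sum of linear images, so
  -- the same lemma applies three times.
  have d1 := fderiv_sum_smul_clm I w A (fun i z => f i z - k i)
      (y := y) (fun i hi => ((hf i hi).of_le (by norm_num)).sub contDiffAt_const)
  simp only [fderiv_sub_const] at d1
  have d2 := (d1.fderiv (𝕜 := ℝ)).trans (fderiv_sum_smul_clm I w _ _
    fun i hi => (h1 i hi).of_le (by norm_num))
  have d3 := (d2.fderiv (𝕜 := ℝ)).trans (fderiv_sum_smul_clm I w _ _ h2)
  exact ⟨d1.eq_of_nhds, d2.eq_of_nhds, d3.eq_of_nhds⟩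

end PostComposition

theorem continuous_modelJet {m : ℕ} (a : ℝ) : Continuous
    (fun x : (Model m →L[ℝ] Model m →L[ℝ] ℝ) × (Model m →L[ℝ] Model m →L[ℝ] Model m) ×
      (Model m →L[ℝ] Model m →L[ℝ] Model m →L[ℝ] Model m) => modelJet a x.1 x.2.1 x.2.2) := by
  unfold modelJet
  refine Continuous.prodMk ?_ (Continuous.prodMk ?_ ?_)
  · refine continuous_pi fun i => continuous_pi fun j => ?_
    fun_prop
  · refine continuous_pi fun i => continuous_pi fun j => continuous_pi fun k => ?_
    fun_prop
  · refine continuous_pi fun i => continuous_pi fun j => continuous_pi fun k =>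
      continuous_pi fun l => ?_
    fun_prop

theorem jetArrayAt_congr {m : ℕ} {g g' : Fin m → Fin m → Model m → ℝ} {y : Model m}
    (h : ∀ i j, g i j =ᶠ[𝓝 y] g' i j) : jetArrayAt g y = jetArrayAt g' y := by
  have h1 : ∀ i j k, partialDeriv k (g i j) =ᶠ[𝓝 y] partialDeriv k (g' i j) := fun i j k =>
    ((h i j).fderiv (𝕜 := ℝ)).mono fun z hz => by simp only [partialDeriv, hz]
  simp only [jetArrayAt, Prod.mk.injEq]
  refine ⟨?_, ?_, ?_⟩
  · funext i j; exact (h i j).eq_of_nhds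
  · funext i j k; exact (h1 i j k).eq_of_nhds
  · funext i j k l
    simp only [partialDeriv]
    exact congrArg (fun L : Model m →L[ℝ] ℝ => L (stdVec l)) (h1 i j k).fderiv_eq

/-- A linear change of the coordinates `φ` is compensated by the scalar product. This is why the
normalizing chart does not matter for the averaged metric. -/
theorem pullMetric_clm_comp {m : ℕ} (a : ℝ) {B B' : Model m →L[ℝ] Model m →L[ℝ] ℝ}
    (L : Model m →L[ℝ] Model m) (hL : ∀ u v, B u v = B' (L u) (L v)) {φ φ' : Model m → Model m}
    (hφ' : ∀ z, φ' z = L (φ z)) {y : Model m} (hφ : DifferentiableAt ℝ φ y) (i j : Fin m) :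
    pullMetric a B φ i j y = pullMetric a B' φ' i j y := by
  have h : fderiv ℝ φ' y = L ∘L fderiv ℝ φ y := by
    rw [show φ' = L ∘ φ from funext hφ']
    exact (L.hasFDerivAt.comp y hφ.hasFDerivAt).fderiv
  simp only [pullMetric, h, hφ', hL, ContinuousLinearMap.comp_apply]

/-! ### Averaged coordinates and scalar products -/

section Averaging

variable {m : ℕ} {M : Type*} [TopologicalSpace M] [ChartedSpace (Model m) M]
  (ρ : PartitionOfUnity M M univ)

/-- The average, with weights `ρ i p`, of the coordinate systems around `p` given by the charts
`chartAt i`, normalized to vanish at `p` and to have the same derivative there as `e`. -/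
def coordMap (e : OpenPartialHomeomorph M (Model m)) (p x : M) : Model m :=
  ∑ᶠ i, ρ i p • fderiv ℝ (e ∘ (chartAt (Model m) i).symm) (chartAt (Model m) i p)
    (chartAt (Model m) i x - chartAt (Model m) i p)

/-- The average, with weights `ρ i p`, of the scalar products at `p` given by the charts
`chartAt i`, in the coordinates `e`. -/
def scalarProd (e : OpenPartialHomeomorph M (Model m)) (p : M) : Model m →L[ℝ] Model m →L[ℝ] ℝ :=
  ∑ᶠ i, ρ i p • (innerSL ℝ).bilinearComp (fderiv ℝ (chartAt (Model m) i ∘ e.symm) (e p))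
    (fderiv ℝ (chartAt (Model m) i ∘ e.symm) (e p))

variable {ρ} {e c : OpenPartialHomeomorph M (Model m)} {p : M}

theorem sum_weights {I : Finset M} (hI : Function.support (fun i => ρ i p) ⊆ I) :
    ∑ i ∈ I, ρ i p = 1 := by
  rw [← finsum_eq_sum_of_support_subset _ hI]
  exact ρ.sum_eq_one (mem_univ p)

theorem finsum_weights_smul {V : Type*} [AddCommGroup V] [Module ℝ V] {I : Finset M}
    (hI : Function.support (fun i => ρ i p) ⊆ I) (G : M → V) :
    ∑ᶠ i, ρ i p • G i = ∑ i ∈ I, ρ i p • G i := by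
  refine finsum_eq_sum_of_support_subset _ fun i hi => hI fun h0 => hi ?_
  simp only [h0, zero_smul]

/-- `G i` is controlled only on the domain of the chart at `i`. Subordination and local finiteness
reduce the sum near a point to finitely many indices whose chart domains all contain that point. -/
theorem continuousOn_finsum_weights_smul {V : Type*} [NormedAddCommGroup V] [NormedSpace ℝ V]
    (hρ : ρ.IsSubordinate fun i => (chartAt (Model m) i).source) {S : Set M} {G : M → M → V}
    (hG : ∀ i, ∀ p ∈ S, p ∈ (chartAt (Model m) i).source → ContinuousAt (G i) p) :
    ContinuousOn (fun p => ∑ᶠ i, ρ i p • G i p) S := by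
  intro p hp
  obtain ⟨I, n, hn, hnI, hs⟩ := ρ.exists_finset_nhds_support_subset hρ
    (fun i => (chartAt (Model m) i).open_source) p
  refine ContinuousAt.continuousWithinAt ?_
  have hc : ContinuousAt (fun p => ∑ i ∈ I, ρ i p • G i p) p := by
    refine tendsto_finsetSum I fun i hi => ?_
    exact ((ρ i).continuous.continuousAt).smul
      (hG i p hp (mem_iInter₂.1 (hnI (mem_of_mem_nhds hn)) i hi))
  refine hc.congr ?_
  filter_upwards [hn] with z hz
  exact (finsum_weights_smul (hs z hz) fun i => G i z).symm

theorem exists_finset_support_subset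
    (hρ : ρ.IsSubordinate fun i => (chartAt (Model m) i).source) (p : M) :
    ∃ I : Finset M, Function.support (fun i => ρ i p) ⊆ I ∧
      ∀ i ∈ I, p ∈ (chartAt (Model m) i).source := by
  obtain ⟨I, n, hn, hnI, hs⟩ := ρ.exists_finset_nhds_support_subset hρ
    (fun i => (chartAt (Model m) i).open_source) p
  exact ⟨I, hs p (mem_of_mem_nhds hn), mem_iInter₂.1 (hnI (mem_of_mem_nhds hn))⟩

theorem coordMap_self (e : OpenPartialHomeomorph M (Model m)) (p : M) : coordMap ρ e p p = 0 := by
  simp [coordMap]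

theorem scalarProd_apply {I : Finset M} (hI : Function.support (fun i => ρ i p) ⊆ I)
    (u v : Model m) : scalarProd ρ e p u v =
      ∑ i ∈ I, ρ i p * inner ℝ (fderiv ℝ (chartAt (Model m) i ∘ e.symm) (e p) u)
        (fderiv ℝ (chartAt (Model m) i ∘ e.symm) (e p) v) := by
  rw [scalarProd, finsum_weights_smul hI]
  simp [sum_apply]

theorem scalarProd_symm
    (hρ : ρ.IsSubordinate fun i => (chartAt (Model m) i).source) (u v : Model m) : scalarProd ρ e p u v = scalarProd ρ e p v u := by
  obtain ⟨I, hI, -⟩ := exists_finset_support_subset hρ p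
  rw [scalarProd_apply hI, scalarProd_apply hI]
  exact Finset.sum_congr rfl fun i _ => by rw [real_inner_comm]

variable [IsManifold 𝓘(ℝ, Model m) ∞ M]

theorem chartAt_mem_charts (i : M) : chartAt (Model m) i ∈ charts m M :=
  IsManifold.chart_mem_maximalAtlas i

/-- Some weight at `p` is positive, and the derivative of the corresponding transition map is
injective because the reverse transition inverts it. -/
theorem scalarProd_pos
    (hρ : ρ.IsSubordinate fun i => (chartAt (Model m) i).source) (he : e ∈ charts m M) (hpe : p ∈ e.source) {u : Model m} (hu : u ≠ 0) :
    0 < scalarProd ρ e p u u := by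
  obtain ⟨I, hI, hpI⟩ := exists_finset_support_subset hρ p
  rw [scalarProd_apply hI]
  obtain ⟨i, hi⟩ := ρ.exists_pos (mem_univ p)
  refine Finset.sum_pos' (fun j _ => mul_nonneg (ρ.nonneg j p) real_inner_self_nonneg)
    ⟨i, hI hi.ne', mul_pos hi (real_inner_self_pos.2 fun h0 => hu ?_)⟩
  have h := fderiv_transition_comp he he (chartAt_mem_charts i) hpe hpe (hpI i (hI hi.ne'))
  rw [fderiv_transition_self hpe] at h
  have := congrArg (fun L : Model m →L[ℝ] Model m => L u) h
  simp only [ContinuousLinearMap.comp_apply, h0, map_zero] at this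
  exact this.symm

/-- The weights are evaluated at `p` and every summand is normalized by a linear map into the
coordinates of the chart, so the derivative of the transition map factors out by the cocycle rule.
-/
theorem coordMap_change
    (hρ : ρ.IsSubordinate fun i => (chartAt (Model m) i).source) (he : e ∈ charts m M) (hc : c ∈ charts m M) (hpe : p ∈ e.source)
    (hpc : p ∈ c.source) (x : M) :
    coordMap ρ e p x = fderiv ℝ (e ∘ c.symm) (c p) (coordMap ρ c p x) := by
  obtain ⟨I, hI, hpI⟩ := exists_finset_support_subset hρ p
  rw [coordMap, coordMap, finsum_weights_smul hI, finsum_weights_smul hI, map_sum]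
  refine Finset.sum_congr rfl fun i hi => ?_
  rw [map_smul, ← ContinuousLinearMap.comp_apply,
    fderiv_transition_comp he (chartAt_mem_charts i) hc hpe (hpI i hi) hpc]

theorem scalarProd_change
    (hρ : ρ.IsSubordinate fun i => (chartAt (Model m) i).source) (he : e ∈ charts m M) (hc : c ∈ charts m M) (hpe : p ∈ e.source)
    (hpc : p ∈ c.source) (u v : Model m) :
    scalarProd ρ c p u v = scalarProd ρ e p (fderiv ℝ (e ∘ c.symm) (c p) u)
      (fderiv ℝ (e ∘ c.symm) (c p) v) := by
  obtain ⟨I, hI, hpI⟩ := exists_finset_support_subset hρ p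
  rw [scalarProd_apply hI, scalarProd_apply hI]
  refine Finset.sum_congr rfl fun i hi => ?_
  rw [← fderiv_transition_comp (chartAt_mem_charts i) hc he (hpI i hi) hpc hpe]
  rfl

theorem exists_contMDiffOn_coordMap
    (hρ : ρ.IsSubordinate fun i => (chartAt (Model m) i).source) (e : OpenPartialHomeomorph M (Model m)) (p : M) :
    ∃ U : Set M, IsOpen U ∧ p ∈ U ∧
      ContMDiffOn 𝓘(ℝ, Model m) 𝓘(ℝ, Model m) ∞ (coordMap ρ e p) U := by
  obtain ⟨I, hI, hpI⟩ := exists_finset_support_subset hρ p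
  refine ⟨⋂ i ∈ I, (chartAt (Model m) i).source,
    isOpen_biInter_finset fun i _ => (chartAt (Model m) i).open_source, mem_iInter₂.2 hpI, ?_⟩
  have hsum : coordMap ρ e p = fun x => ∑ i ∈ I, ρ i p •
      fderiv ℝ (e ∘ (chartAt (Model m) i).symm) (chartAt (Model m) i p)
        (chartAt (Model m) i x - chartAt (Model m) i p) :=
    funext fun x => finsum_weights_smul hI _
  rw [hsum]
  intro x hx
  refine ContMDiffAt.contMDiffWithinAt ?_
  refine ContMDiffAt.sum fun i hi => ?_
  have h1 : ContMDiffAt 𝓘(ℝ, Model m) 𝓘(ℝ, Model m) ∞ (chartAt (Model m) i) x :=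
    contMDiffAt_of_mem_maximalAtlas (chartAt_mem_charts i) (mem_iInter₂.1 hx i hi)
  have h2 : ContDiff ℝ ∞ (fun z : Model m => ρ i p •
      fderiv ℝ (e ∘ (chartAt (Model m) i).symm) (chartAt (Model m) i p)
        (z - chartAt (Model m) i p)) := by fun_prop
  exact h2.contMDiff.contMDiffAt.comp x h1

theorem contDiffAt_coordMap
    (hρ : ρ.IsSubordinate fun i => (chartAt (Model m) i).source) (he : e ∈ charts m M) (hpe : p ∈ e.source)
    (c : OpenPartialHomeomorph M (Model m)) : ContDiffAt ℝ ∞ (coordMap ρ c p ∘ e.symm) (e p) := by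
  obtain ⟨U, hU, hp, hψ⟩ := exists_contMDiffOn_coordMap hρ c p
  have h1 : ContMDiffAt 𝓘(ℝ, Model m) 𝓘(ℝ, Model m) ∞ e.symm (e p) :=
    (contMDiffOn_symm_of_mem_maximalAtlas he).contMDiffAt
      (e.open_target.mem_nhds (e.map_source hpe))
  exact (ContMDiffAt.comp_of_eq (hψ.contMDiffAt (hU.mem_nhds hp)) h1 (e.left_inv hpe)).contDiffAt

/-- The first three derivatives at `p` of the averaged coordinates. -/
theorem fderiv_coordMap
    (hρ : ρ.IsSubordinate fun i => (chartAt (Model m) i).source) (he : e ∈ charts m M) (hpe : p ∈ e.source) :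
    fderiv ℝ (coordMap ρ e p ∘ e.symm) (e p) = ContinuousLinearMap.id ℝ (Model m) ∧
    fderiv ℝ (fderiv ℝ (coordMap ρ e p ∘ e.symm)) (e p) =
      ∑ᶠ i, ρ i p • postBilinear
        (fderiv ℝ (e ∘ (chartAt (Model m) i).symm) (chartAt (Model m) i p))
        (fderiv ℝ (fderiv ℝ (chartAt (Model m) i ∘ e.symm)) (e p)) ∧
    fderiv ℝ (fderiv ℝ (fderiv ℝ (coordMap ρ e p ∘ e.symm))) (e p) =
      ∑ᶠ i, ρ i p • postTrilinear
        (fderiv ℝ (e ∘ (chartAt (Model m) i).symm) (chartAt (Model m) i p))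
        (fderiv ℝ (fderiv ℝ (fderiv ℝ (chartAt (Model m) i ∘ e.symm))) (e p)) := by
  obtain ⟨I, hI, hpI⟩ := exists_finset_support_subset hρ p
  obtain ⟨d1, d2, d3⟩ := fderiv_iterated_sum_smul_clm I (fun i => ρ i p)
    (fun i => fderiv ℝ (e ∘ (chartAt (Model m) i).symm) (chartAt (Model m) i p))
    (fun i => chartAt (Model m) i ∘ e.symm) (fun i => chartAt (Model m) i p)
    (fun i hi => (contDiffAt_transition he (chartAt_mem_charts i) hpe (hpI i hi)).of_le
      (by norm_cast)) (φ := coordMap ρ e p ∘ e.symm) (fun z => finsum_weights_smul hI _)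
  refine ⟨?_, d2.trans (finsum_weights_smul hI _).symm, d3.trans (finsum_weights_smul hI _).symm⟩
  -- Each summand has derivative the identity in the chart `e`, and the weights add up to 1: the
  -- normalization survives averaging.
  rw [d1, ← one_smul ℝ (ContinuousLinearMap.id ℝ (Model m)), ← sum_weights hI, Finset.sum_smul]
  refine Finset.sum_congr rfl fun i hi => ?_
  rw [fderiv_transition_comp he he (chartAt_mem_charts i) hpe hpe (hpI i hi),
    fderiv_transition_self hpe]

theorem continuousOn_scalarProd
    (hρ : ρ.IsSubordinate fun i => (chartAt (Model m) i).source) (he : e ∈ charts m M) :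
    ContinuousOn (scalarProd ρ e) e.source := by
  refine continuousOn_finsum_weights_smul hρ fun i p hpe hpi => ?_
  have h := (continuousAt_fderiv_transition he (chartAt_mem_charts i) hpe hpi).1
  exact ((contDiff_bilinearComp_self (innerSL ℝ)).continuous.continuousAt).comp
    (f := fun x => fderiv ℝ (chartAt (Model m) i ∘ e.symm) (e x)) h

theorem continuousOn_fderiv_fderiv_coordMap
    (hρ : ρ.IsSubordinate fun i => (chartAt (Model m) i).source) (he : e ∈ charts m M) :
    ContinuousOn (fun p => fderiv ℝ (fderiv ℝ (coordMap ρ e p ∘ e.symm)) (e p)) e.source := by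
  refine ContinuousOn.congr ?_ fun p hpe => (fderiv_coordMap hρ he hpe).2.1
  refine continuousOn_finsum_weights_smul hρ fun i p hpe hpi => ?_
  have hA := (continuousAt_fderiv_transition (chartAt_mem_charts i) he hpi hpe).1
  have hT := (continuousAt_fderiv_transition he (chartAt_mem_charts i) hpe hpi).2.1
  exact continuousAt_postBilinear hA hT

theorem continuousOn_fderiv_fderiv_fderiv_coordMap
    (hρ : ρ.IsSubordinate fun i => (chartAt (Model m) i).source) (he : e ∈ charts m M) :
    ContinuousOn (fun p => fderiv ℝ (fderiv ℝ (fderiv ℝ (coordMap ρ e p ∘ e.symm))) (e p))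
      e.source := by
  have h := continuousOn_finsum_weights_smul (S := e.source) (G := fun i p => postTrilinear
    (fderiv ℝ (e ∘ (chartAt (Model m) i).symm) (chartAt (Model m) i p))
    (fderiv ℝ (fderiv ℝ (fderiv ℝ (chartAt (Model m) i ∘ e.symm))) (e p))) hρ ?_
  · exact h.congr fun p hpe => (fderiv_coordMap hρ he hpe).2.2
  intro i p hpe hpi
  have hA := (continuousAt_fderiv_transition (chartAt_mem_charts i) he hpi hpe).1
  have hT := (continuousAt_fderiv_transition he (chartAt_mem_charts i) hpe hpi).2.2
  exact continuousAt_postTrilinear hA hT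

theorem continuousOn_modelJet_coordMap
    (hρ : ρ.IsSubordinate fun i => (chartAt (Model m) i).source) (he : e ∈ charts m M) (a : ℝ) :
    ContinuousOn (fun p => modelJet a (scalarProd ρ e p)
      (fderiv ℝ (fderiv ℝ (coordMap ρ e p ∘ e.symm)) (e p))
      (fderiv ℝ (fderiv ℝ (fderiv ℝ (coordMap ρ e p ∘ e.symm))) (e p))) e.source :=
  (continuous_modelJet a).comp_continuousOn ((continuousOn_scalarProd hρ he).prodMk
    ((continuousOn_fderiv_fderiv_coordMap hρ he).prodMk
      (continuousOn_fderiv_fderiv_fderiv_coordMap hρ he)))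

/-- At each point there is a local metric whose 2-jet is given, in every chart, by `modelJet`. -/
theorem exists_localMetric_jetCoord_eq
    (hρ : ρ.IsSubordinate fun i => (chartAt (Model m) i).source) (a : ℝ) (p : M) : ∃ g : LocalMetric m M, g.base = p ∧
    ∀ e ∈ charts m M, p ∈ e.source → g.jetCoord e = modelJet a (scalarProd ρ e p)
      (fderiv ℝ (fderiv ℝ (coordMap ρ e p ∘ e.symm)) (e p))
      (fderiv ℝ (fderiv ℝ (fderiv ℝ (coordMap ρ e p ∘ e.symm))) (e p)) := by
  have hc := chartAt_mem_charts (m := m) p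
  have hpc := mem_chart_source (Model m) p
  obtain ⟨U, hU, hp, hψ⟩ := exists_contMDiffOn_coordMap hρ (chartAt (Model m) p) p
  obtain ⟨g, rfl, hg⟩ := exists_localMetric_pullMetric a (scalarProd_symm hρ)
    (fun u => scalarProd_pos hρ hc hpc) hU hp hψ (coordMap_self _ p) hc hpc
    (by rw [(fderiv_coordMap hρ hc hpc).1]; exact isUnit_one)
  refine ⟨g, rfl, fun e he hpe => ?_⟩
  have hs := contDiffAt_coordMap hρ he hpe e
  rw [← jetArrayAt_pullMetric a (scalarProd_symm hρ) (hs.of_le (by norm_cast))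
    (by rw [Function.comp_apply, e.left_inv hpe, coordMap_self]) (fderiv_coordMap hρ he hpe).1]
  -- `g` was built from the averages normalized in the chart at its base point, while the jet in `e`
  -- refers to those normalized in `e`. The two pulled-back metrics agree near the base point.
  refine jetArrayAt_congr fun i j => (hg e he hpe i j).trans ?_
  have hev : ∀ᶠ y in 𝓝 (e g.base),
      ContDiffAt ℝ 1 (coordMap ρ (chartAt (Model m) g.base) g.base ∘ e.symm) y :=
    ((contDiffAt_coordMap hρ he hpe _).of_le (by norm_cast)).eventually (by simp)
  filter_upwards [hev] with y hy
  exact pullMetric_clm_comp a _ (scalarProd_change hρ he hc hpe hpc)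
    (fun z => coordMap_change hρ he hc hpe hpc _) (hy.differentiableAt (by simp)) i j

/-- Local metrics with the 2-jet `modelJet` have constant sectional curvature at the base point. -/
theorem sec_eq_of_jetCoord_eq
    (hρ : ρ.IsSubordinate fun i => (chartAt (Model m) i).source) {a : ℝ} {g : LocalMetric m M}
    (hg : ∀ e ∈ charts m M, g.base ∈ e.source → g.jetCoord e = modelJet a (scalarProd ρ e g.base)
      (fderiv ℝ (fderiv ℝ (coordMap ρ e g.base ∘ e.symm)) (e g.base))
      (fderiv ℝ (fderiv ℝ (fderiv ℝ (coordMap ρ e g.base ∘ e.symm))) (e g.base)))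
    {v w : TangentSpace 𝓘(ℝ, Model m) g.base} (hvw : LinearIndependent ℝ ![v, w]) :
    g.sec g.base v w = a := by
  have hc := chartAt_mem_charts (m := m) g.base
  have hpc := mem_chart_source (Model m) g.base
  have hs := contDiffAt_coordMap hρ hc hpc (chartAt (Model m) g.base)
  have h3 := fderiv_fderiv_fderiv_symm (hs.of_le (m := 3) (by norm_cast))
  have h2 := (hs.of_le (m := 2) (by norm_cast)).isSymmSndFDerivAt (by simp)
  refine coordSec_of_modelJet (g.contDiffAt_component hc hpc) (g.det_component_ne_zero hc hpc)
    (scalarProd_symm hρ) (fun u => scalarProd_pos hρ hc hpc) (fun u v => h2.eq u v) h3.1 h3.2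
    (hg _ hc hpc) ?_
  -- The curvature is evaluated on the images of `v`, `w` under the derivative of the preferred
  -- chart, so linear independence must be carried over.
  have hinj := (mdifferentiable_chart (I := 𝓘(ℝ, Model m)) g.base).mfderiv_injective hpc
  rw [LinearIndependent.pair_iff] at hvw
  refine LinearIndependent.pair_iff.2 fun s t hst => ?_
  refine hvw s t (hinj ?_)
  rw [map_add, map_smul, map_smul, map_zero]
  exact hst

end Averaging

/-! ### Assembling the section -/

theorem self_mem_pinchInterval {δ : ℝ} (hδ : 0 ≤ δ) (a : ℝ) : a ∈ pinchInterval δ a := by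
  unfold pinchInterval
  split_ifs with h
  · rfl
  · have : 0 < δ := lt_of_le_of_ne hδ (Ne.symm h)
    constructor <;> linarith

end CurvatureRelation

end

open CurvatureRelation in
/-- On every smooth manifold (of any dimension `m`, without boundary, Hausdorff and second
countable) the curvature relation has a formal solution. -/
theorem mainTheorem2 (m : ℕ) (M : Type*) [TopologicalSpace M] [T2Space M]
    [SecondCountableTopology M] [ChartedSpace (CurvatureRelation.Model m) M]
    [IsManifold 𝓘(ℝ, CurvatureRelation.Model m) ∞ M] (a δ : ℝ) (hδ : 0 ≤ δ) :
    (CurvatureRelation.formalSolutions m M δ a).Nonempty := by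
  -- With second countability and the Hausdorff property this gives paracompactness, hence
  -- partitions of unity. A continuous one suffices, because the weights are never differentiated.
  have : LocallyCompactSpace M := ChartedSpace.locallyCompactSpace (Model m) M
  obtain ⟨ρ, hρ⟩ := PartitionOfUnity.exists_isSubordinate (ι := M) (X := M) isClosed_univ
    (fun i => (chartAt (Model m) i).source) (fun i => (chartAt (Model m) i).open_source)
    (fun x _ => mem_iUnion.2 ⟨x, mem_chart_source _ x⟩)
  -- The germs at different points are chosen independently; continuity of their jets comes solely
  -- from the explicit formula in `hjet`.
  choose g hbase hjet using exists_localMetric_jetCoord_eq (m := m) hρ a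
  have hcont : Continuous fun p => MetricJet.mk (g p) := by
    -- It suffices to treat generating open sets, whose preimages lie in one chart domain; there the
    -- chart description of the section is `modelJet` of continuous data.
    refine continuous_generateFrom_iff.2 ?_
    rintro O ⟨e, W, hW, rfl⟩
    have hproj : ∀ p, (MetricJet.mk (g p)).proj = p := hbase
    have hcoord : ContinuousOn (fun p => (e.1 p, MetricJet.coord e (MetricJet.mk (g p))))
        e.1.source := by
      refine e.1.continuousOn.prodMk ?_
      refine (continuousOn_modelJet_coordMap hρ e.2 a).congr fun p hp => ?_
      have h : MetricJet.coord e (MetricJet.mk (g p)) = (g p).jetCoord e.1 :=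
        if_pos (by rw [hbase p]; exact hp)
      rw [h, hjet p e.1 e.2 hp]
    have := hcoord.isOpen_inter_preimage e.1.open_source hW
    convert this using 1
    ext p
    simp only [mem_preimage, mem_ofPred_eq, mem_inter_iff, hproj]
  refine ⟨⟨_, hcont⟩, hbase, fun p v w hvw => ?_⟩
  have hsec : (g p).sec (g p).base v w = a :=
    sec_eq_of_jetCoord_eq hρ (fun e he hpe => by
      have := hjet p e he (by rw [← hbase p]; exact hpe)
      rw [this, hbase p]) hvw
  have : (MetricJet.mk (g p)).sec v w = a := hsec
  exact this ▸ self_mem_pinchInterval hδ a
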